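/- Let $n\ge 1$, let $(W,S)$ be a Coxeter system of type $A_{n-1}$ with $S=\{s_1,\dots,s_{n-1}\}$ (so $W\cong S_n$), let $R$ be a commutative ring, and let $u\colon S\to R^\times$, $s\mapsto u_s$, be a map with $u_s=u_{t}$ whenever $s,t\in S$ are conjugate in $W$. Let $\Phi$ be the root system of $(W,S)$ in its standard geometric representation, with simple roots $\alpha_s$ ($s\in S$). A root subsystem is a (possibly empty) subset of $\Phi$ stable under the reflections in its own elements. Root subsystems form a commutative monoid $\Sigma(\Phi)$ under $\Psi_1\cdot\Psi_2=\langle\Psi_1,\Psi_2\rangle$ (the root subsystem generated by $\Psi_1\cup\Psi_2$), on which $W$ acts. Put $e_s=\langle\alpha_s\rangle=\{\pm\alpha_s\}$, let $\Sigma(\Phi)_{[e]}$ be the submonoid generated by all $w.e_s$ ($w\in W$, $s\in S$), let $A=R[\Sigma(\Phi)_{[e]}]$ be its monoid algebra with the induced $W$-action $\rho$, and let $\hat e_s=1+(u_s-1)e_s\in A^\times$. Let $B_W$ be the Artin braid group of $(W,S)$ with standard generators $g_s$, acting on $A$ through $B_W\to W$, and let $\mathcal E^{(W,S)}(A,\rho,\hat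 e)$ be the quotient of the semidirect product $A\rtimes R[B_W]$ (in which $g\,c=(g.c)\,g$ for $g\in B_W$, $c\in A$) by the two-sided ideal generated by the elements $g_s^2-\hat e_s-(1-\hat e_s)g_s$, $s\in S$. This is the Marin algebra attached to the identity homomorphism $\phi=\mathrm{id}_W$ and the map $e\colon s\mapsto\langle\alpha_s\rangle$. For $q\in R^\times$ let $\mathcal E_n=\mathcal E_n(q)$ be the Aicardi--Juyumaya algebra of braids and ties: the associative unital $R$-algebra generated by $g_1,\dots,g_{n-1},e_1,\dots,e_{n-1}$ subject to \begin{align*} g_ig_j&=g_jg_i &&\text{if } |i-j|>1,\\ g_ig_jg_i&=g_jg_ig_j &&\text{if } |i-j|=1,\\ g_i^2&=1+(q-1)e_i(1-g_i),\\ g_ie_j&=e_jg_i &&\text{if } |i-j|\neq 1,\\ g_jg_ie_j&=e_ig_jg_i &&\text{if } |i-j|=1,\\ e_ie_j&=e_je_i,\qquad e_i^2=e_i,\\ e_ie_jg_j&=e_ig_je_i=g_je_ie_j &&\text{if } |i-j|=1. \end{align*} Proposition. The map $u$ is constant: there is $q\in R^\times$ with $u_s=q$ for all $s\in S$. For every such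 $q$ the algebra $\mathcal E^{(W,S)}(R[\Sigma(\Phi)_{[e]}],\rho,\hat e)$ coincides with $\mathcal E_n(q)$: there is an isomorphism of $R$-algebras $$\mathcal E_n(q)\;\xrightarrow{\ \sim\ }\;\mathcal E^{(W,S)}(R[\Sigma(\Phi)_{[e]}],\rho,\hat e),\qquad g_i\mapsto g_{s_i},\quad e_i\mapsto e_{s_i}\qquad(1\le i\le n-1).$$ -/

import Mathlib

noncomputable section

namespace BraidsTies

/-! ### Artin groups -/

section Artin

variable {B : Type*} (M : CoxeterMatrix B)

/-- The Artin braid group attached to a Coxeter matrix: generators `B`, and for all `i, j` the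
relation between the two alternating words of length `M i j` in `i, j`
(no relation when `M i j = 0`, which encodes `∞`). -/
abbrev ArtinGroup : Type _ :=
  PresentedGroup {r : FreeGroup B | ∃ i j : B,
    r = ((CoxeterSystem.braidWord M i j).map FreeGroup.of).prod *
      (((CoxeterSystem.braidWord M j i).map FreeGroup.of).prod)⁻¹}

/-- The standard generator of the Artin group. -/
def artinGen (i : B) : ArtinGroup M := PresentedGroup.of i

variable {M} {W : Type*} [Group W] (cs : CoxeterSystem M W)

/-- The canonical projection from the Artin group to the Coxeter group. -/
def artinProj : ArtinGroup M →* W :=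
  PresentedGroup.toGroup (f := cs.simple) (by
    rintro r ⟨i, j, rfl⟩
    have h := cs.wordProd_braidWord_eq i j
    simp only [CoxeterSystem.wordProd] at h
    simp [map_list_prod, List.map_map, Function.comp_def, h])

theorem artinProj_gen (i : B) : artinProj cs (artinGen M i) = cs.simple i :=
  PresentedGroup.toGroup.of _

end Artin

/-! ### The standard geometric representation -/

section Geometric

variable {B : Type*} (M : CoxeterMatrix B)

/-- The space `V_W` of the geometric representation, with basis the simple roots. -/
abbrev GeomSpace (B : Type*) : Type _ := B →₀ ℝ

/-- The simple root `α_i`. -/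
def simpleRoot (i : B) : GeomSpace B := Finsupp.single i 1

/-- The canonical bilinear form, `⟨α_i, α_j⟩ = - cos (π / m_{ij})`. The value `M i j = 0` encodes
`m_{ij} = ∞`; then `π / 0 = 0` and the form takes the usual value `-1`. -/
def geomForm : GeomSpace B →ₗ[ℝ] GeomSpace B →ₗ[ℝ] ℝ :=
  Finsupp.linearCombination ℝ fun i => Finsupp.linearCombination ℝ fun j =>
    - Real.cos (Real.pi / (M i j : ℝ))

/-- The map `σ_v : x ↦ x - 2 ⟨v, x⟩ v`, the reflection in `v` when `⟨v, v⟩ = 1`. -/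
def refl (v : GeomSpace B) : GeomSpace B →ₗ[ℝ] GeomSpace B :=
  Module.preReflection v ((2 : ℝ) • geomForm M v)

theorem refl_apply (v x : GeomSpace B) :
    refl M v x = x - (2 * geomForm M v x) • v := by
  simp [refl, Module.preReflection_apply]

theorem geomForm_simple (i j : B) :
    geomForm M (simpleRoot i) (simpleRoot j) = - Real.cos (Real.pi / (M i j : ℝ)) := by
  simp [geomForm, simpleRoot]

theorem geomForm_simple_self (i : B) : geomForm M (simpleRoot i) (simpleRoot i) = 1 := by
  simp [geomForm_simple]

theorem geomForm_symm (x y : GeomSpace B) : geomForm M x y = geomForm M y x := by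
  have h : geomForm M = (geomForm M).flip := by
    ext i j
    have := geomForm_simple M i j
    have h2 := geomForm_simple M j i
    simp only [simpleRoot] at this h2
    simp [this, h2, M.symmetric i j]
  conv_lhs => rw [h]
  rfl

theorem two_form_simple (i : B) :
    ((2 : ℝ) • geomForm M (simpleRoot i)) (simpleRoot i) = 2 := by
  simp [geomForm_simple_self]

/-- The reflection in the simple root `α_i`, as a linear automorphism. -/
def simpleRefl (i : B) : GeomSpace B ≃ₗ[ℝ] GeomSpace B :=
  Module.reflection (two_form_simple M i)

theorem simpleRefl_apply (i : B) (x : GeomSpace B) :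
    simpleRefl M i x = refl M (simpleRoot i) x := rfl

open Polynomial.Chebyshev in
theorem simpleRefl_liftable : M.IsLiftable (simpleRefl M) := by
  intro i j
  by_cases hij : i = j
  · subst hij
    rw [M.diagonal, pow_one]
    ext1 x
    exact Module.involutive_reflection (two_form_simple M i) x
  rcases Nat.eq_zero_or_pos (M i j) with h0 | hpos
  · rw [h0, pow_zero]
  have h1 := M.off_diagonal i j hij
  set m := M i j with hm
  set c := Real.cos (Real.pi / (m : ℝ)) with hc
  have hfy : ((2 : ℝ) • geomForm M (simpleRoot i)) (simpleRoot j) = -(2 * c) := by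
    simp [geomForm_simple, hc, hm]
  have hgx : ((2 : ℝ) • geomForm M (simpleRoot j)) (simpleRoot i) = -(2 * c) := by
    simp [geomForm_simple, hc, hm, M.symmetric j i]
  apply LinearEquiv.ext
  intro z
  have key := Module.reflection_mul_reflection_pow_apply (two_form_simple M i)
    (two_form_simple M j) m z
  change ((simpleRefl M i * simpleRefl M j) ^ m) z = _ at key
  rw [key, hfy, hgx]
  by_cases h2 : m = 2
  · have hc0 : c = 0 := by
      rw [hc, h2]; simp
    rw [h2, hc0]
    norm_num [S_one]
    abel
  have h3 : 3 ≤ m := by omega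
  set θ : ℝ := 2 * (Real.pi / m) with hθ
  have ht : -(2 * c) * -(2 * c) - 2 = 2 * Real.cos θ := by
    rw [hθ, Real.cos_two_mul, hc]; ring
  have hm0 : (0 : ℝ) < m := by exact_mod_cast hpos
  have hsin : Real.sin θ ≠ 0 := by
    apply ne_of_gt
    apply Real.sin_pos_of_pos_of_lt_pi
    · positivity
    · rw [hθ]
      have : (3 : ℝ) ≤ m := by exact_mod_cast h3
      rw [← mul_div_assoc, div_lt_iff₀ hm0]
      nlinarith [Real.pi_pos]
  have hS (k : ℤ) := S_two_mul_real_cos θ k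
  have hθm : (m : ℝ) * θ = 2 * Real.pi := by rw [hθ]; field_simp
  rw [ht]
  obtain ⟨k, hk | hk⟩ := Nat.even_or_odd' m
  · have e1 : ((m : ℤ) - 2) / 2 = k - 1 := by omega
    have e2 : ((m : ℤ) - 1) / 2 = k - 1 := by omega
    have z1 : (S ℝ ((k : ℤ) - 1)).eval (2 * Real.cos θ) = 0 := by
      have := hS ((k : ℤ) - 1)
      have hz : ((((k : ℤ) - 1 : ℤ) : ℝ) + 1) * θ = Real.pi := by
        push_cast
        have : (m : ℝ) = 2 * k := by exact_mod_cast hk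
        rw [this] at hθm
        linarith
      rw [hz, Real.sin_pi] at this
      exact (mul_eq_zero.mp this).resolve_right hsin
    rw [e1, e2, z1]
    simp
  · have e1 : ((m : ℤ) - 2) / 2 = k - 1 := by omega
    have e2 : ((m : ℤ) - 1) / 2 = k := by omega
    have e3 : ((m : ℤ) - 3) / 2 = k - 1 := by omega
    have e4 : (m : ℤ) / 2 = k := by omega
    have z1 : (S ℝ (k : ℤ)).eval (2 * Real.cos θ) +
        (S ℝ ((k : ℤ) - 1)).eval (2 * Real.cos θ) = 0 := by
      have a1 := hS (k : ℤ)
      have a2 := hS ((k : ℤ) - 1)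
      have hz : ((k : ℝ) + 1) * θ = 2 * Real.pi - k * θ := by
        have : (m : ℝ) = 2 * k + 1 := by exact_mod_cast hk
        rw [this] at hθm
        linarith
      have hz2 : ((((k : ℤ) - 1 : ℤ) : ℝ) + 1) * θ = k * θ := by push_cast; ring
      rw [hz2] at a2
      rw [Int.cast_natCast, hz, Real.sin_two_pi_sub] at a1
      have : ((S ℝ (k : ℤ)).eval (2 * Real.cos θ) +
        (S ℝ ((k : ℤ) - 1)).eval (2 * Real.cos θ)) * Real.sin θ = 0 := by
        rw [add_mul, a1, a2]; ring
      exact (mul_eq_zero.mp this).resolve_right hsin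
    rw [e1, e2, e3, e4, z1]
    simp

variable {M} {W : Type*} [Group W] (cs : CoxeterSystem M W)

/-- The standard geometric representation, sending `s_i` to the reflection in `α_i`. -/
def geomRep : W →* (GeomSpace B ≃ₗ[ℝ] GeomSpace B) :=
  cs.lift ⟨simpleRefl M, simpleRefl_liftable M⟩

theorem geomRep_simple (i : B) : geomRep cs (cs.simple i) = simpleRefl M i :=
  cs.lift_apply_simple (simpleRefl_liftable M) i

theorem geomForm_geomRep (w : W) (x y : GeomSpace B) :
    geomForm M (geomRep cs w x) (geomRep cs w y) = geomForm M x y := by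
  induction w using cs.simple_induction generalizing x y with
  | simple i =>
    simp only [geomRep_simple, simpleRefl_apply, refl_apply, map_sub, map_smul,
      LinearMap.sub_apply, LinearMap.smul_apply, smul_eq_mul, geomForm_simple_self,
      geomForm_symm M x (simpleRoot i)]
    ring
  | one => simp
  | mul w w' h h' => simp [LinearEquiv.mul_apply, h, h']

theorem refl_geomRep (w : W) (v x : GeomSpace B) :
    refl M (geomRep cs w v) (geomRep cs w x) = geomRep cs w (refl M v x) := by
  simp [refl_apply, geomForm_geomRep]

/-- The root system `Φ_W`: the orbit of the simple roots. -/
def roots : Set (GeomSpace B) := {v | ∃ (w : W) (i : B), v = geomRep cs w (simpleRoot i)}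

theorem geomRep_mem_roots (w : W) {v : GeomSpace B} (hv : v ∈ roots cs) :
    geomRep cs w v ∈ roots cs := by
  obtain ⟨w', i, rfl⟩ := hv
  exact ⟨w * w', i, by simp [LinearEquiv.mul_apply]⟩

theorem refl_simple_conj (w : W) (i : B) (x : GeomSpace B) :
    refl M (geomRep cs w (simpleRoot i)) x = geomRep cs (w * cs.simple i * w⁻¹) x := by
  have h := refl_geomRep cs w (simpleRoot i) (geomRep cs w⁻¹ x)
  rw [← LinearEquiv.mul_apply, ← map_mul, mul_inv_cancel, map_one, LinearEquiv.coe_one, id] at h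
  rw [h, ← simpleRefl_apply, ← geomRep_simple cs i, ← LinearEquiv.mul_apply,
    ← LinearEquiv.mul_apply, ← map_mul, ← map_mul]

theorem refl_mem_roots {v x : GeomSpace B} (hv : v ∈ roots cs) (hx : x ∈ roots cs) :
    refl M v x ∈ roots cs := by
  obtain ⟨w, i, rfl⟩ := hv
  rw [refl_simple_conj]
  exact geomRep_mem_roots cs _ hx

end Geometric

/-! ### The monoid of root subsystems -/

/-- A root subsystem of `Φ_W`: a (possibly empty) set of roots that is stable under the
reflections in its own elements. -/
@[ext]
structure RootSubsystem {B : Type*} {M : CoxeterMatrix B} {W : Type*} [Group W]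
    (cs : CoxeterSystem M W) where
  carrier : Set (GeomSpace B)
  subset_roots : carrier ⊆ roots cs
  refl_mem : ∀ v ∈ carrier, ∀ x ∈ carrier, refl M v x ∈ carrier

namespace RootSubsystem

variable {B : Type*} {M : CoxeterMatrix B} {W : Type*} [Group W] {cs : CoxeterSystem M W}

/-- The root subsystem `⟨X⟩` generated by a set `X` of roots: the intersection of all root
subsystems that contain `X`. -/
def generate (X : Set (GeomSpace B)) (hX : X ⊆ roots cs) : RootSubsystem cs where
  carrier := {v | ∀ Ψ : RootSubsystem cs, X ⊆ Ψ.carrier → v ∈ Ψ.carrier}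
  subset_roots := fun _ hv =>
    hv ⟨roots cs, subset_rfl, fun _ h _ h' => refl_mem_roots cs h h'⟩ hX
  refl_mem := fun v hv x hx Ψ hΨ => Ψ.refl_mem v (hv Ψ hΨ) x (hx Ψ hΨ)

theorem subset_generate (X : Set (GeomSpace B)) (hX : X ⊆ roots cs) :
    X ⊆ (generate X hX).carrier := fun _ hv _ hΨ => hΨ hv

theorem generate_subset {X : Set (GeomSpace B)} {hX : X ⊆ roots cs} {Ψ : RootSubsystem cs}
    (h : X ⊆ Ψ.carrier) : (generate X hX).carrier ⊆ Ψ.carrier := fun _ hv => hv Ψ h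

/-- The composition law: `Ψ₁ * Ψ₂ = ⟨Ψ₁, Ψ₂⟩`. -/
instance : Mul (RootSubsystem cs) :=
  ⟨fun Ψ₁ Ψ₂ => generate (Ψ₁.carrier ∪ Ψ₂.carrier)
    (Set.union_subset Ψ₁.subset_roots Ψ₂.subset_roots)⟩

/-- The unit is the empty root subsystem. -/
instance : One (RootSubsystem cs) :=
  ⟨⟨∅, Set.empty_subset _, fun _ h => absurd h (Set.notMem_empty _)⟩⟩

theorem mul_subset_iff {Ψ₁ Ψ₂ Ψ : RootSubsystem cs} :
    (Ψ₁ * Ψ₂).carrier ⊆ Ψ.carrier ↔ Ψ₁.carrier ⊆ Ψ.carrier ∧ Ψ₂.carrier ⊆ Ψ.carrier := by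
  constructor
  · intro h
    have h' := (subset_generate (cs := cs) (Ψ₁.carrier ∪ Ψ₂.carrier)
      (Set.union_subset Ψ₁.subset_roots Ψ₂.subset_roots)).trans h
    exact Set.union_subset_iff.mp h'
  · intro h
    exact generate_subset (Set.union_subset_iff.mpr h)

theorem ext_of_subset_iff {Ψ₁ Ψ₂ : RootSubsystem cs}
    (h : ∀ Ψ : RootSubsystem cs, Ψ₁.carrier ⊆ Ψ.carrier ↔ Ψ₂.carrier ⊆ Ψ.carrier) : Ψ₁ = Ψ₂ :=
  RootSubsystem.ext (((h Ψ₂).mpr subset_rfl).antisymm ((h Ψ₁).mp subset_rfl))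

instance : CommMonoid (RootSubsystem cs) where
  mul_assoc a b c := ext_of_subset_iff fun Ψ => by simp only [mul_subset_iff, and_assoc]
  one_mul a := ext_of_subset_iff fun Ψ => by
    rw [mul_subset_iff]
    exact ⟨fun h => h.2, fun h => ⟨Set.empty_subset _, h⟩⟩
  mul_one a := ext_of_subset_iff fun Ψ => by
    rw [mul_subset_iff]
    exact ⟨fun h => h.1, fun h => ⟨h, Set.empty_subset _⟩⟩
  mul_comm a b := ext_of_subset_iff fun Ψ => by simp only [mul_subset_iff, and_comm]

theorem mul_self (Ψ : RootSubsystem cs) : Ψ * Ψ = Ψ :=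
  ext_of_subset_iff fun Ψ' => by simp only [mul_subset_iff, and_self]

/-- The action of `W` on root subsystems, through the geometric representation. -/
instance : MulAction W (RootSubsystem cs) where
  smul w Ψ :=
    { carrier := geomRep cs w '' Ψ.carrier
      subset_roots := by
        rintro _ ⟨v, hv, rfl⟩
        exact geomRep_mem_roots cs w (Ψ.subset_roots hv)
      refl_mem := by
        rintro _ ⟨v, hv, rfl⟩ _ ⟨x, hx, rfl⟩
        exact ⟨_, Ψ.refl_mem v hv x hx, (refl_geomRep cs w v x).symm⟩ }
  one_smul Ψ := by
    apply RootSubsystem.ext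
    change geomRep cs 1 '' Ψ.carrier = Ψ.carrier
    simp
  mul_smul w w' Ψ := by
    apply RootSubsystem.ext
    change geomRep cs (w * w') '' Ψ.carrier = geomRep cs w '' (geomRep cs w' '' Ψ.carrier)
    rw [Set.image_image, map_mul]
    rfl

theorem smul_carrier (w : W) (Ψ : RootSubsystem cs) :
    (w • Ψ).carrier = geomRep cs w '' Ψ.carrier := rfl

theorem smul_subset_smul (w : W) {Ψ Ψ' : RootSubsystem cs} (h : Ψ.carrier ⊆ Ψ'.carrier) :
    (w • Ψ).carrier ⊆ (w • Ψ').carrier := Set.image_mono h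

theorem smul_subset_iff {w : W} {Ψ Ψ' : RootSubsystem cs} :
    (w • Ψ).carrier ⊆ Ψ'.carrier ↔ Ψ.carrier ⊆ (w⁻¹ • Ψ').carrier := by
  constructor <;> intro h
  · simpa using smul_subset_smul w⁻¹ h
  · simpa using smul_subset_smul w h

instance : MulDistribMulAction W (RootSubsystem cs) where
  smul_mul w a b := ext_of_subset_iff fun Ψ => by
    simp only [mul_subset_iff, smul_subset_iff]
  smul_one w := by
    apply RootSubsystem.ext
    change geomRep cs w '' (∅ : Set _) = ∅
    simp

variable (cs) in
/-- The root subsystem `⟨s_i⟩ = ⟨α_i⟩` generated by the simple root `α_i`. -/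
def ofSimple (i : B) : RootSubsystem cs :=
  generate {simpleRoot i} (Set.singleton_subset_iff.mpr ⟨1, i, by simp⟩)

theorem ofSimple_subset_iff {i : B} {Ψ : RootSubsystem cs} :
    (ofSimple cs i).carrier ⊆ Ψ.carrier ↔ simpleRoot i ∈ Ψ.carrier :=
  ⟨fun h => h (subset_generate _ _ rfl),
    fun h => generate_subset (Set.singleton_subset_iff.mpr h)⟩

theorem neg_mem {Ψ : RootSubsystem cs} {v : GeomSpace B} (h : v ∈ Ψ.carrier) :
    -v ∈ Ψ.carrier := by
  have h1 := Ψ.refl_mem v h v h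
  obtain ⟨w, i, hv⟩ := Ψ.subset_roots h
  have h2 : geomForm M v v = 1 := by rw [hv, geomForm_geomRep, geomForm_simple_self]
  rw [refl_apply, h2] at h1
  convert h1 using 1
  module

theorem smul_ofSimple {w : W} {i j : B} (h : w * cs.simple i * w⁻¹ = cs.simple j) :
    w • ofSimple cs i = ofSimple cs j := by
  set β := geomRep cs w (simpleRoot i) with hβ
  have hβ1 : geomForm M β β = 1 := by rw [hβ, geomForm_geomRep, geomForm_simple_self]
  have h1 : refl M β β = refl M (simpleRoot j) β := by
    rw [hβ, refl_simple_conj, h, geomRep_simple, simpleRefl_apply]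
  rw [refl_apply, refl_apply, hβ1] at h1
  set c := geomForm M (simpleRoot j) β with hc
  have h2 : β = c • simpleRoot j := by
    have h4 : (2 : ℝ) • β = (2 : ℝ) • (c • simpleRoot j) := by
      rw [smul_smul]
      have := sub_right_injective h1
      simpa using this
    exact smul_right_injective _ (two_ne_zero (α := ℝ)) h4
  have h3 : c = 1 ∨ c = -1 := by
    rw [h2] at hβ1
    simp only [map_smul, LinearMap.smul_apply, geomForm_simple_self, smul_eq_mul, mul_one] at hβ1
    exact mul_self_eq_one_iff.mp hβ1
  refine ext_of_subset_iff fun Ψ => ?_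
  rw [smul_subset_iff, ofSimple_subset_iff, ofSimple_subset_iff, smul_carrier]
  have h5 : simpleRoot i ∈ geomRep cs w⁻¹ '' Ψ.carrier ↔ β ∈ Ψ.carrier := by
    constructor
    · rintro ⟨x, hx, hxi⟩
      rw [hβ, ← hxi, ← LinearEquiv.mul_apply, ← map_mul]
      simpa using hx
    · intro hx
      refine ⟨β, hx, ?_⟩
      rw [hβ, ← LinearEquiv.mul_apply, ← map_mul]
      simp
  rw [h5, h2]
  rcases h3 with h3 | h3 <;> rw [h3]
  · simp
  · rw [neg_one_smul]
    exact ⟨fun hx => by simpa using neg_mem hx, neg_mem⟩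

theorem ofSimple_mul_smul (i : B) (Ψ : RootSubsystem cs) :
    ofSimple cs i * Ψ = ofSimple cs i * (cs.simple i • Ψ) := by
  have key (Ψ : RootSubsystem cs) (Θ : RootSubsystem cs) (hi : simpleRoot i ∈ Θ.carrier)
      (h : Ψ.carrier ⊆ Θ.carrier) : (cs.simple i • Ψ).carrier ⊆ Θ.carrier := by
    rintro _ ⟨x, hx, rfl⟩
    rw [geomRep_simple, simpleRefl_apply]
    exact Θ.refl_mem _ hi _ (h hx)
  refine ext_of_subset_iff fun Θ => ?_
  rw [mul_subset_iff, mul_subset_iff, ofSimple_subset_iff]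
  refine and_congr_right fun hi => ⟨key Ψ Θ hi, fun h => ?_⟩
  have := key _ Θ hi h
  rwa [smul_smul, cs.simple_mul_simple_self, one_smul] at this

end RootSubsystem

/-! ### Marin rings -/

section Marin

variable {B : Type*} {M : CoxeterMatrix B} {W : Type*} [Group W] (cs : CoxeterSystem M W)

/-- Equivariance of a map `S → X` into a type with trivial `W`-action, for the conjugation action
on `W`: the map is constant on simple reflections that are conjugate in `W`. -/
def ConjInvariant {X : Type*} (u : B → X) : Prop :=
  ∀ (i j : B) (w : W), w * cs.simple i * w⁻¹ = cs.simple j → u i = u j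

/-- The data `(A, ρ, a)` which together with the Coxeter system `cs` form a Marin datum. -/
structure MarinDatum (k A : Type*) [CommRing k] [CommRing A] [Algebra k A] where
  /-- the action of `W` on `A` -/
  ρ : W →* (A ≃ₐ[k] A)
  /-- the units `a_s` -/
  a : B → Aˣ
  equivariant : ∀ (i j : B) (w : W), w * cs.simple i * w⁻¹ = cs.simple j →
    ρ w (a i : A) = (a j : A)

namespace MarinDatum

variable {cs} {k A : Type*} [CommRing k] [CommRing A] [Algebra k A] (D : MarinDatum cs k A)

/-- The Artin group, as a type that remembers the Marin datum and so acts on `A`. -/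
def Braid (_D : MarinDatum cs k A) : Type _ := ArtinGroup M

instance : Group D.Braid := inferInstanceAs (Group (ArtinGroup M))

/-- The projection from the Artin group to `W`. -/
def proj : D.Braid →* W := artinProj cs

/-- The Artin generator `g_s`. -/
def braidGen (i : B) : D.Braid := artinGen M i

/-- The Artin group acts on `A` through its projection to `W`. -/
instance : MulSemiringAction D.Braid A := MulSemiringAction.compHom A (D.ρ.comp D.proj)

theorem braid_smul (g : D.Braid) (c : A) : g • c = D.ρ (D.proj g) c := rfl

instance : SMulCommClass D.Braid k A := ⟨fun g r c => map_smul (D.ρ (D.proj g)) r c⟩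

/-- The semidirect product `A ⋊ k[B_W]`: the free left `A`-module on the Artin group, with the
multiplication `(c g) (d h) = (c * (g • d)) (g h)`. Here `SkewMonoidAlgebra.single g c` is the
element `c g`. -/
abbrev SemidirectProduct : Type _ := SkewMonoidAlgebra A D.Braid

/-- The element `g_s` of the semidirect product. -/
def sgen (i : B) : D.SemidirectProduct := SkewMonoidAlgebra.single (D.braidGen i) 1

/-- The element `c` of `A` in the semidirect product. -/
def scoeff (c : A) : D.SemidirectProduct := SkewMonoidAlgebra.single 1 c

/-- The defining relators `g_s ^ 2 - a_s - (1 - a_s) g_s` of the Marin ring. -/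
inductive Rel : D.SemidirectProduct → D.SemidirectProduct → Prop
  | quadratic (i : B) : Rel
      (D.sgen i ^ 2 - D.scoeff (D.a i : A) - D.scoeff (1 - (D.a i : A)) * D.sgen i) 0

/-- The Marin ring: the quotient of the semidirect product `A ⋊ k[B_W]` by the two-sided ideal
generated by the elements `g_s ^ 2 - a_s - (1 - a_s) g_s`. -/
abbrev MarinRing : Type _ := RingQuot D.Rel

/-- The class of an Artin generator in the Marin ring. -/
def gen (i : B) : D.MarinRing := RingQuot.mkAlgHom k D.Rel (D.sgen i)

/-- The class of an element of `A` in the Marin ring. -/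
def coeff (c : A) : D.MarinRing := RingQuot.mkAlgHom k D.Rel (D.scoeff c)

end MarinDatum

end Marin

/-! ### Juyumaya maps and the associated algebras -/

/-- A Juyumaya map `(φ, e)` between Coxeter systems `(W, S)` and `(U, T)`. -/
structure JuyumayaMap {B C : Type*} {M : CoxeterMatrix B} {N : CoxeterMatrix C}
    {W U : Type*} [Group W] [Group U] (cs : CoxeterSystem M W) (ct : CoxeterSystem N U) where
  /-- the group homomorphism -/
  φ : W →* U
  /-- the map to root subsystems -/
  e : B → RootSubsystem ct
  equivariant : ∀ (i j : B) (w : W), w * cs.simple i * w⁻¹ = cs.simple j → φ w • e i = e j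
  tie : ∀ (i j : B) (w : W), e i * (φ w • e j) = e i * (φ (cs.simple i * w) • e j)

namespace JuyumayaMap

variable {B C : Type*} {M : CoxeterMatrix B} {N : CoxeterMatrix C}
  {W U : Type*} [Group W] [Group U] {cs : CoxeterSystem M W} {ct : CoxeterSystem N U}

variable (cs) in
/-- The identity Juyumaya map `s ↦ ⟨s⟩` of a Coxeter system. -/
def identity : JuyumayaMap cs cs where
  φ := MonoidHom.id W
  e := RootSubsystem.ofSimple cs
  equivariant _ _ _ h := RootSubsystem.smul_ofSimple h
  tie i j w := by
    rw [MonoidHom.id_apply, MonoidHom.id_apply, mul_smul]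
    exact RootSubsystem.ofSimple_mul_smul i _

variable (J : JuyumayaMap cs ct)

/-- The submonoid `Σ(Φ_U)_{[e]}` generated by the elements `w • e_s`. -/
def ties : Submonoid (RootSubsystem ct) :=
  Submonoid.closure {x | ∃ (w : W) (i : B), x = J.φ w • J.e i}

theorem smul_mem_ties (w : W) {x : RootSubsystem ct} (hx : x ∈ J.ties) : J.φ w • x ∈ J.ties := by
  induction hx using Submonoid.closure_induction with
  | mem x hx =>
    obtain ⟨w', i, rfl⟩ := hx
    exact Submonoid.subset_closure ⟨w * w', i, by rw [map_mul, mul_smul]⟩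
  | one => rw [smul_one]; exact one_mem _
  | mul x y _ _ hx hy => rw [smul_mul']; exact mul_mem hx hy

/-- The element `e_s` of `Σ(Φ_U)_{[e]}`. -/
def tie' (i : B) : J.ties :=
  ⟨J.e i, Submonoid.subset_closure ⟨1, i, by simp⟩⟩

/-- The action of `W` on the monoid `Σ(Φ_U)_{[e]}`. -/
def tiesAction : W →* MulAut J.ties where
  toFun w :=
    { toFun := fun x => ⟨J.φ w • (x : RootSubsystem ct), J.smul_mem_ties w x.2⟩
      invFun := fun x => ⟨J.φ w⁻¹ • (x : RootSubsystem ct), J.smul_mem_ties w⁻¹ x.2⟩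
      left_inv := fun x => by ext1; simp
      right_inv := fun x => by ext1; simp
      map_mul' := fun x y => by ext1; simp [smul_mul'] }
  map_one' := by ext1 x; ext1; simp
  map_mul' w w' := by ext1 x; ext1; simp [mul_smul]

variable (R : Type*) [CommRing R]

/-- The induced action `ρ_φ` of `W` on the monoid algebra `R[Σ(Φ_U)_{[e]}]`. -/
def tiesAlgAction : W →* (MonoidAlgebra R J.ties ≃ₐ[R] MonoidAlgebra R J.ties) where
  toFun w := MonoidAlgebra.domCongr R R (J.tiesAction w)
  map_one' := by
    rw [map_one]
    exact MonoidAlgebra.domCongr_refl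
  map_mul' w w' := by
    rw [map_mul]
    apply AlgEquiv.ext
    intro x
    induction x using MonoidAlgebra.induction_linear with
    | zero => simp
    | add x y hx hy => rw [map_add, map_add, hx, hy]
    | single m r => simp [AlgEquiv.mul_apply]

variable {R}

/-- The element `e_s` of the monoid algebra `R[Σ(Φ_U)_{[e]}]`. -/
def tieElt (i : B) : MonoidAlgebra R J.ties := MonoidAlgebra.of R J.ties (J.tie' i)

theorem tieElt_mul_self (i : B) : J.tieElt (R := R) i * J.tieElt i = J.tieElt i := by
  rw [tieElt, ← map_mul]
  congr 1
  exact Subtype.ext (RootSubsystem.mul_self _)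

/-- The units `ê_s = 1 + (u_s - 1) e_s`, with inverse `1 + u_s⁻¹ (1 - u_s) e_s`. -/
def hatE (u : B → Rˣ) (i : B) : (MonoidAlgebra R J.ties)ˣ where
  val := 1 + ((u i : R) - 1) • J.tieElt i
  inv := 1 + (((u i)⁻¹ : Rˣ) * (1 - (u i : R))) • J.tieElt i
  val_inv := by
    have h := J.tieElt_mul_self (R := R) i
    have hu : (((u i)⁻¹ : Rˣ) : R) * (u i : R) = 1 := Units.inv_mul _
    rw [add_mul, mul_add, mul_add, smul_mul_smul_comm, h, one_mul, one_mul, mul_one, add_assoc,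
      ← add_smul, ← add_smul]
    rw [show (((u i)⁻¹ : Rˣ) : R) * (1 - (u i : R)) + ((u i : R) - 1 + ((u i : R) - 1) *
      ((((u i)⁻¹ : Rˣ) : R) * (1 - (u i : R)))) = 0 by linear_combination (1 - (u i : R)) * hu]
    simp
  inv_val := by
    have h := J.tieElt_mul_self (R := R) i
    have hu : (((u i)⁻¹ : Rˣ) : R) * (u i : R) = 1 := Units.inv_mul _
    rw [add_mul, mul_add, mul_add, smul_mul_smul_comm, h, one_mul, one_mul, mul_one, add_assoc,
      ← add_smul, ← add_smul]
    rw [show ((u i : R) - 1) + ((((u i)⁻¹ : Rˣ) : R) * (1 - (u i : R)) +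
      ((((u i)⁻¹ : Rˣ) : R) * (1 - (u i : R))) * ((u i : R) - 1)) = 0 by
        linear_combination (1 - (u i : R)) * hu]
    simp

/-- The Marin datum `(R[Σ(Φ_U)_{[e]}], ρ_φ, ê)`. -/
def marinDatum (u : B → Rˣ) (hu : ConjInvariant cs u) :
    MarinDatum cs R (MonoidAlgebra R J.ties) where
  ρ := J.tiesAlgAction R
  a := J.hatE u
  equivariant i j w h := by
    have h1 : J.tiesAction w (J.tie' i) = J.tie' j := Subtype.ext (J.equivariant i j w h)
    have h2 : J.tiesAlgAction R w (J.tieElt i) = J.tieElt j := by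
      simp [tiesAlgAction, tieElt, h1]
    simp [hatE, h2, hu i j w h]

end JuyumayaMap

/-! ### The algebra of braids and ties of type A -/

/-- Generators `g_1, …, g_{n-1}, e_1, …, e_{n-1}` (indexed from `0`). -/
inductive BTGen (n : ℕ) : Type
  | g (i : Fin (n - 1))
  | e (i : Fin (n - 1))

/-- The distance `|i - j|` of two indices. -/
def idxDist {m : ℕ} (i j : Fin m) : ℤ := |((i : ℕ) : ℤ) - ((j : ℕ) : ℤ)|

section BT

variable (R : Type*) [CommRing R] (n : ℕ)

/-- The generator `g_i` in the free algebra. -/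
def fg (i : Fin (n - 1)) : FreeAlgebra R (BTGen n) := FreeAlgebra.ι R (BTGen.g i)

/-- The generator `e_i` in the free algebra. -/
def fe (i : Fin (n - 1)) : FreeAlgebra R (BTGen n) := FreeAlgebra.ι R (BTGen.e i)

/-- The defining relations of the algebra of braids and ties with parameter `q`. -/
inductive BTRel (q : R) : FreeAlgebra R (BTGen n) → FreeAlgebra R (BTGen n) → Prop
  | gg (i j) : 1 < idxDist i j → BTRel q (fg R n i * fg R n j) (fg R n j * fg R n i)
  | ggg (i j) : idxDist i j = 1 →
      BTRel q (fg R n i * fg R n j * fg R n i) (fg R n j * fg R n i * fg R n j)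
  | quadratic (i) : BTRel q (fg R n i ^ 2) (1 + (q - 1) • (fe R n i * (1 - fg R n i)))
  | ge (i j) : idxDist i j ≠ 1 → BTRel q (fg R n i * fe R n j) (fe R n j * fg R n i)
  | gge (i j) : idxDist i j = 1 →
      BTRel q (fg R n j * fg R n i * fe R n j) (fe R n i * fg R n j * fg R n i)
  | ee (i j) : BTRel q (fe R n i * fe R n j) (fe R n j * fe R n i)
  | idem (i) : BTRel q (fe R n i ^ 2) (fe R n i)
  | eeg (i j) : idxDist i j = 1 →
      BTRel q (fe R n i * fe R n j * fg R n j) (fe R n i * fg R n j * fe R n i)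
  | ege (i j) : idxDist i j = 1 →
      BTRel q (fe R n i * fg R n j * fe R n i) (fg R n j * fe R n i * fe R n j)

/-- The algebra `𝓔_n` of braids and ties over `R` with parameter `q`. -/
abbrev BTAlgebra (q : R) : Type _ := RingQuot (BTRel R n q)

variable {R n}

/-- The generator `g_i` of `𝓔_n`. -/
def BTAlgebra.g (q : R) (i : Fin (n - 1)) : BTAlgebra R n q :=
  RingQuot.mkAlgHom R (BTRel R n q) (fg R n i)

/-- The generator `e_i` of `𝓔_n`. -/
def BTAlgebra.e (q : R) (i : Fin (n - 1)) : BTAlgebra R n q :=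
  RingQuot.mkAlgHom R (BTRel R n q) (fe R n i)

end BT

end BraidsTies

end

noncomputable section

namespace BraidsTies

/-! Adjacent simple reflections are conjugate in type A, so `u` is constant. One direction of the
isomorphism is a check of relations: every defining relation of the algebra of braids and ties holds
in the Marin ring (`exists_algHom_marinRing`).

The substance is the inverse. The Marin ring is generated by braids and by a monoid of root
subsystems, so its universal property asks for a monoid homomorphism from that monoid to 𝓔_n sending
`⟨α_i⟩` to `e_i` and turning the braid action into conjugation by the `g_i`. No presentation of the
monoid is given, so well-definedness must be proved: if two products of transported subsystems `w •
⟨α_i⟩` coincide, the corresponding products of conjugates of the `e_i` must coincide in 𝓔_n.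

Conjugation yields ties `t_{ab}`, one for each pair of points of {0, …, m}, and the braid generators
permute them as adjacent transpositions permute the pairs, although the `g_i` are not involutions
(`smul_tieOf`). The ties commute and satisfy `t_{ab} t_{bd} = t_{ab} t_{ad}`. Hence, for each x, the
relation `t_{ab} x = x` is an equivalence relation on the points, and the roots ε_a - ε_b with a ~ b
form a root subsystem. It contains a transported simple root exactly when x absorbs the
corresponding tie (`smul_ofSimple_subset_iff`). Thus equal subsystems give tie products that absorb
each other; since these commute, they are equal (`tieProd_congr`). Neither an identification of W
with a symmetric group nor a classification of root subsystems is needed.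

The argument takes place in a monoid with a group action satisfying a short list of axioms,
`IsTieSystem`; 𝓔_n under conjugation by its units is an instance. -/

/-- The relations satisfied by the conjugation action of the generators `g_i` of the algebra of
braids and ties on the ties `e_j`, in an arbitrary monoid `X` acted on by a group `G`. The indices
range over `0, …, m - 1`. -/
structure IsTieSystem {G X : Type*} [Group G] [Monoid X] [MulDistribMulAction G X] (m : ℕ)
    (c : ℕ → G) (e : ℕ → X) : Prop where
  comm : ∀ i j, i + 1 < j → j < m → c i * c j = c j * c i
  braid : ∀ i, i + 1 < m → c i * c (i + 1) * c i = c (i + 1) * c i * c (i + 1)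
  fix : ∀ i j, i < m → j < m → i + 1 ≠ j → j + 1 ≠ i → c i • e j = e j
  move_succ : ∀ i, i + 1 < m → c i • c (i + 1) • e i = e (i + 1)
  move_pred : ∀ i, i + 1 < m → c (i + 1) • c i • e (i + 1) = e i
  sq_succ : ∀ i, i + 1 < m → c (i + 1) • c (i + 1) • e i = e i
  idem : ∀ i, i < m → e i * e i = e i
  tie_comm : ∀ i j, i < j → j < m → e i * e j = e j * e i
  tie : ∀ i, i + 1 < m → e i * e (i + 1) = e i * c (i + 1) • e i

/-! ### Ties between arbitrary pairs of points, permuted by adjacent transpositions. -/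

section Arc

variable {G X : Type*} [Group G] [Monoid X] [MulDistribMulAction G X] {m : ℕ}
  (c : ℕ → G) (e : ℕ → X)

/-- The tie joining `a` and `b` for `a < b`, obtained by transporting `e_a`; it is `1` if
`b ≤ a`. -/
def arc (a : ℕ) : ℕ → X
  | 0 => 1
  | b + 1 => if a < b then c b • arc a b else if a = b then e b else 1

theorem arc_succ_self (a : ℕ) : arc c e a (a + 1) = e a := by simp [arc]

theorem arc_succ_of_lt {a b : ℕ} (h : a < b) : arc c e a (b + 1) = c b • arc c e a b := by
  simp [arc, h]

theorem arc_of_le {a b : ℕ} (h : b ≤ a) : arc c e a b = 1 := by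
  cases b with
  | zero => rfl
  | succ b => rw [arc, if_neg (by omega), if_neg (by omega)]

variable {c e}

namespace IsTieSystem

variable (H : IsTieSystem m c e)
include H

theorem smul_comm_of_lt {i j : ℕ} (hij : i + 1 < j) (hj : j < m) (x : X) :
    c i • c j • x = c j • c i • x := by
  rw [← mul_smul, H.comm i j hij hj, mul_smul]

theorem smul_arc_of_outside {k a b : ℕ} (hab : a < b) (hb : b ≤ m) (hk : k < m)
    (h : k + 1 < a ∨ b < k) : c k • arc c e a b = arc c e a b := by
  induction b, hab using Nat.le_induction with
  | base =>
    rw [Nat.succ_eq_add_one, arc_succ_self]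
    exact H.fix _ _ hk (by omega) (by omega) (by omega)
  | succ b hab ih =>
    rw [arc_succ_of_lt c e hab]
    rcases h with h | h
    · rw [H.smul_comm_of_lt (by omega) (by omega), ih (by omega) (Or.inl h)]
    · rw [← H.smul_comm_of_lt (by omega) (by omega), ih (by omega) (Or.inr (by omega))]

theorem smul_arc_of_inside {k a b : ℕ} (hb : b ≤ m) (hak : a < k) (hkb : k + 1 < b) :
    c k • arc c e a b = arc c e a b := by
  induction b, hkb using Nat.le_induction with
  | base =>
    rw [Nat.succ_eq_add_one, arc_succ_of_lt c e (by omega : a < k + 1),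
      arc_succ_of_lt c e (by omega : a < k)]
    -- The arc is `c_{k+1} c_k` applied to the arc ending at k. The braid relation moves a `c_{k+1}`
    -- to the right, where it fixes that shorter arc.
    rw [← mul_smul, ← mul_smul, H.braid k (by omega), mul_smul, mul_smul,
      H.smul_arc_of_outside (by omega) (by omega) (by omega) (Or.inr (by omega))]
  | succ b hkb ih =>
    rw [arc_succ_of_lt c e (by omega : a < b), H.smul_comm_of_lt (by omega) (by omega),
      ih (by omega)]

theorem smul_arc_left {a b : ℕ} (hab : a + 1 < b) (hb : b ≤ m) :
    c a • arc c e a b = arc c e (a + 1) b := by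
  induction b, hab using Nat.le_induction with
  | base =>
    rw [Nat.succ_eq_add_one, arc_succ_of_lt c e (by omega : a < a + 1), arc_succ_self,
      arc_succ_self, H.move_succ a (by omega)]
  | succ b hab ih =>
    rw [arc_succ_of_lt c e (by omega : a < b), arc_succ_of_lt c e (by omega : a + 1 < b),
      H.smul_comm_of_lt (by omega) (by omega), ih (by omega)]

theorem smul_arc_left_pred {a b : ℕ} (hab : a + 1 < b) (hb : b ≤ m) :
    c a • arc c e (a + 1) b = arc c e a b := by
  induction b, hab using Nat.le_induction with
  | base =>
    rw [Nat.succ_eq_add_one, arc_succ_of_lt c e (by omega : a < a + 1), arc_succ_self,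
      arc_succ_self]
    -- The claim is `c_a • e_{a+1} = c_{a+1} • e_a`: applying `c_{a+1}` turns both sides into `e_a`.
    exact MulAction.injective (c (a + 1))
      ((H.move_pred a (by omega)).trans (H.sq_succ a (by omega)).symm)
  | succ b hab ih =>
    rw [arc_succ_of_lt c e (by omega : a < b), arc_succ_of_lt c e (by omega : a + 1 < b),
      H.smul_comm_of_lt (by omega) (by omega), ih (by omega)]

/-- This replaces the missing relation `c_k² = 1`. Arcs of length one are the axiom `sq_succ`; a
longer arc is `c_a` applied to the arc starting at a + 1, and `c_a` commutes with `c_k`. -/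
theorem sq_smul_arc {a k : ℕ} (hak : a < k) (hk : k < m) :
    c k • c k • arc c e a k = arc c e a k := by
  obtain ⟨d, rfl⟩ : ∃ d, k = a + 1 + d := ⟨k - a - 1, by omega⟩
  induction d generalizing a with
  | zero => rw [add_zero, arc_succ_self]; exact H.sq_succ a hk
  | succ d ih =>
    rw [← H.smul_arc_left_pred (by omega) hk.le,
      ← H.smul_comm_of_lt (i := a) (by omega) hk, ← H.smul_comm_of_lt (i := a) (by omega) hk]
    refine congrArg (c a • ·) ?_
    have := ih (a := a + 1) (by omega) (by omega)
    rwa [show a + 1 + 1 + d = a + 1 + (d + 1) by omega] at this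

/-- A case distinction on the position of k and k + 1 relative to the endpoints. The minimum and
maximum restore the order of the endpoints, since `arc` is a genuine tie only for increasing
arguments. -/
theorem smul_arc {k a b : ℕ} (hab : a < b) (hb : b ≤ m) (hk : k < m) :
    c k • arc c e a b =
      arc c e (min (Equiv.swap k (k + 1) a) (Equiv.swap k (k + 1) b))
        (max (Equiv.swap k (k + 1) a) (Equiv.swap k (k + 1) b)) := by
  have key {a' b' : ℕ} (h : a' < b') (ha : Equiv.swap k (k + 1) a = a')
      (hb : Equiv.swap k (k + 1) b = b') (h' : c k • arc c e a b = arc c e a' b') :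
      c k • arc c e a b = arc c e (min (Equiv.swap k (k + 1) a) (Equiv.swap k (k + 1) b))
        (max (Equiv.swap k (k + 1) a) (Equiv.swap k (k + 1) b)) := by
    rw [ha, hb, min_eq_left h.le, max_eq_right h.le, h']
  have fixed {x : ℕ} (h1 : x ≠ k) (h2 : x ≠ k + 1) : Equiv.swap k (k + 1) x = x :=
    Equiv.swap_apply_of_ne_of_ne h1 h2
  rcases eq_or_ne k b with rfl | h1
  · exact key (by omega : a < k + 1) (fixed (by omega) (by omega)) (Equiv.swap_apply_left _ _)
      (arc_succ_of_lt c e hab).symm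
  rcases eq_or_ne b (k + 1) with rfl | h2
  · rcases eq_or_ne a k with rfl | h3
    · rw [Equiv.swap_apply_left, Equiv.swap_apply_right, min_eq_right (by omega),
        max_eq_left (by omega), arc_succ_self]
      exact H.fix _ _ hk hk (by omega) (by omega)
    · refine key (by omega : a < k) (fixed h3 (by omega)) (Equiv.swap_apply_right _ _) ?_
      rw [arc_succ_of_lt c e (by omega)]
      exact H.sq_smul_arc (by omega) hk
  have hb' : Equiv.swap k (k + 1) b = b := fixed h1.symm h2
  rcases eq_or_ne a k with rfl | h3
  · exact key (by omega : a + 1 < b) (Equiv.swap_apply_left _ _) hb'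
      (H.smul_arc_left (by omega) hb)
  rcases eq_or_ne a (k + 1) with rfl | h4
  · exact key (by omega : k < b) (Equiv.swap_apply_right _ _) hb'
      (H.smul_arc_left_pred (by omega) hb)
  refine key hab (fixed h3 h4) hb' ?_
  by_cases h5 : a < k ∧ k < b
  · exact H.smul_arc_of_inside hb h5.1 (by omega)
  · exact H.smul_arc_of_outside hab hb hk (by omega)

end IsTieSystem

variable (c e) in
/-- The tie joining two elements of `{0, …, m}`; it is `1` if they are equal. -/
def tieOf (a b : Fin (m + 1)) : X := arc c e (min a b : Fin (m + 1)) (max a b : Fin (m + 1))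

theorem tieOf_comm (a b : Fin (m + 1)) : tieOf c e a b = tieOf c e b a := by
  rw [tieOf, tieOf, min_comm, max_comm]

theorem tieOf_self (a : Fin (m + 1)) : tieOf c e a a = 1 := arc_of_le c e (by simp)

theorem tieOf_castSucc_succ (i : Fin m) : tieOf c e i.castSucc i.succ = e i := by
  rw [tieOf, min_eq_left i.castSucc_lt_succ.le, max_eq_right i.castSucc_lt_succ.le]
  exact arc_succ_self c e i

theorem val_swap_castSucc_succ (i : Fin m) (a : Fin (m + 1)) :
    (Equiv.swap i.castSucc i.succ a : Fin (m + 1)).val =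
      Equiv.swap (i : ℕ) (i + 1) (a : ℕ) := by
  simp only [Equiv.swap_apply_def, Fin.ext_iff, Fin.val_castSucc, Fin.val_succ]
  split_ifs <;> simp

namespace IsTieSystem

variable (H : IsTieSystem m c e)
include H

theorem smul_tieOf (i : Fin m) (a b : Fin (m + 1)) :
    c i • tieOf c e a b =
      tieOf c e (Equiv.swap i.castSucc i.succ a) (Equiv.swap i.castSucc i.succ b) := by
  wlog h : a < b generalizing a b
  · rcases eq_or_lt_of_le (not_lt.mp h) with rfl | h
    · simp [tieOf_self]
    · rw [tieOf_comm, this b a h, tieOf_comm]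
  · have := H.smul_arc (k := i) (Fin.lt_def.mp h) (by omega) i.2
    simp only [tieOf, min_eq_left h.le, max_eq_right h.le, this, ← val_swap_castSucc_succ,
      Fin.val_strictMono.monotone.map_min, Fin.val_strictMono.monotone.map_max]

/-- Adjacent transpositions generate the symmetric group. Existence of γ is enough to transport
identities between ties; no homomorphism σ ↦ γ is required. -/
theorem exists_smul_tieOf (σ : Equiv.Perm (Fin (m + 1))) :
    ∃ γ : G, ∀ a b, γ • tieOf c e a b = tieOf c e (σ a) (σ b) := by
  have hσ : σ ∈ Submonoid.closure (Set.range fun i : Fin m => Equiv.swap i.castSucc i.succ) := by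
    rw [Equiv.Perm.mclosure_swap_castSucc_succ]; trivial
  induction hσ using Submonoid.closure_induction with
  | mem x hx =>
    obtain ⟨i, rfl⟩ := hx
    exact ⟨c i, H.smul_tieOf i⟩
  | one => exact ⟨1, fun a b => by simp⟩
  | mul x y _ _ hx hy =>
    obtain ⟨γ, hγ⟩ := hx
    obtain ⟨δ, hδ⟩ := hy
    exact ⟨γ * δ, fun a b => by rw [mul_smul, hδ, hγ]; rfl⟩

omit H in
theorem exists_perm_eq {k : ℕ} {x : Fin k → Fin (m + 1)} (hx : Function.Injective x)
    (hk : k ≤ m + 1) : ∃ σ : Equiv.Perm (Fin (m + 1)), ∀ i, σ (Fin.castLE hk i) = x i := by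
  have := Equiv.Perm.isMultiplyPretransitive (Fin (m + 1)) k
  obtain ⟨σ, hσ⟩ := MulAction.isMultiplyPretransitive_iff.mp this (Fin.castLEEmb hk) ⟨x, hx⟩
  exact ⟨σ, fun i => DFunLike.congr_fun hσ i⟩

/-- A permutation carries the points 0, 1, 2 to a, b, d, so only the standard triple has to be
treated; there the claims are the axioms `tie` and `tie_comm` for `e_0` and `e_1`. -/
theorem tieOf_mul_tieOf {a b d : Fin (m + 1)} (hab : a ≠ b) (hbd : b ≠ d) (had : a ≠ d) :
    tieOf c e a b * tieOf c e b d = tieOf c e a b * tieOf c e a d ∧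
      tieOf c e a b * tieOf c e b d = tieOf c e b d * tieOf c e a b := by
  have hx : Function.Injective ![a, b, d] := by
    intro i j h
    fin_cases i <;> fin_cases j <;> simp_all [eq_comm]
  -- Three distinct points force m ≥ 2, so `e_0` and `e_1` are within the range of the axioms.
  have hk : 3 ≤ m + 1 := by simpa using Fintype.card_le_of_injective _ hx
  obtain ⟨σ, hσ⟩ := exists_perm_eq hx hk
  obtain ⟨γ, hγ⟩ := H.exists_smul_tieOf σ
  have h0 : σ ⟨0, by omega⟩ = a := hσ 0
  have h1 : σ ⟨1, by omega⟩ = b := hσ 1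
  have h2 : σ ⟨2, by omega⟩ = d := hσ 2
  rw [← h0, ← h1, ← h2, ← hγ, ← hγ, ← hγ, ← smul_mul', ← smul_mul', ← smul_mul']
  have e01 : tieOf c e (⟨0, by omega⟩ : Fin (m + 1)) ⟨1, by omega⟩ = e 0 :=
    tieOf_castSucc_succ (c := c) (e := e) (⟨0, by omega⟩ : Fin m)
  have e12 : tieOf c e (⟨1, by omega⟩ : Fin (m + 1)) ⟨2, by omega⟩ = e 1 :=
    tieOf_castSucc_succ (c := c) (e := e) (⟨1, by omega⟩ : Fin m)
  have e02 : tieOf c e (⟨0, by omega⟩ : Fin (m + 1)) ⟨2, by omega⟩ = c 1 • e 0 := by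
    simp [tieOf, arc]
  rw [e01, e12, e02]
  exact ⟨congrArg _ (H.tie 0 (by omega)), congrArg _ (H.tie_comm 0 1 (by omega) (by omega))⟩

/-- Pairs sharing a point are covered by `tieOf_mul_tieOf`. Disjoint pairs are transported to {0, 1}
and {2, 3}, whose ties are `e_0` and `e_2`. -/
theorem commute_tieOf (a b x y : Fin (m + 1)) : Commute (tieOf c e a b) (tieOf c e x y) := by
  rcases eq_or_ne a b with rfl | hab
  · rw [tieOf_self]; exact Commute.one_left _
  rcases eq_or_ne x y with rfl | hxy
  · rw [tieOf_self]; exact Commute.one_right _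
  have shared {a b d : Fin (m + 1)} (hab : a ≠ b) (hbd : b ≠ d) :
      Commute (tieOf c e a b) (tieOf c e b d) := by
    rcases eq_or_ne a d with rfl | had
    · rw [tieOf_comm]
    · exact (H.tieOf_mul_tieOf hab hbd had).2
  rcases eq_or_ne b x with rfl | h1
  · exact shared hab hxy
  rcases eq_or_ne b y with rfl | h2
  · rw [tieOf_comm x]; exact shared hab hxy.symm
  rcases eq_or_ne a x with rfl | h3
  · rw [tieOf_comm a b]; exact shared hab.symm hxy
  rcases eq_or_ne a y with rfl | h4
  · rw [tieOf_comm a b, tieOf_comm x]; exact shared hab.symm hxy.symm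
  have hx : Function.Injective ![a, b, x, y] := by
    intro i j h
    fin_cases i <;> fin_cases j <;> simp_all [eq_comm]
  have hk : 4 ≤ m + 1 := by simpa using Fintype.card_le_of_injective _ hx
  obtain ⟨σ, hσ⟩ := exists_perm_eq hx hk
  obtain ⟨γ, hγ⟩ := H.exists_smul_tieOf σ
  have h0 : σ ⟨0, by omega⟩ = a := hσ 0
  have h1 : σ ⟨1, by omega⟩ = b := hσ 1
  have h2 : σ ⟨2, by omega⟩ = x := hσ 2
  have h3 : σ ⟨3, by omega⟩ = y := hσ 3
  have e01 : tieOf c e (⟨0, by omega⟩ : Fin (m + 1)) ⟨1, by omega⟩ = e 0 :=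
    tieOf_castSucc_succ (c := c) (e := e) (⟨0, by omega⟩ : Fin m)
  have e23 : tieOf c e (⟨2, by omega⟩ : Fin (m + 1)) ⟨3, by omega⟩ = e 2 :=
    tieOf_castSucc_succ (c := c) (e := e) (⟨2, by omega⟩ : Fin m)
  rw [← h0, ← h1, ← h2, ← h3, ← hγ, ← hγ, Commute, SemiconjBy, ← smul_mul', ← smul_mul', e01, e23,
    H.tie_comm 0 2 (by omega) (by omega)]

/-- Absorption of ties by a fixed element is an equivalence relation on `{0, …, m}`. -/
def absorbSetoid (x : X) : Setoid (Fin (m + 1)) where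
  r a b := tieOf c e a b * x = x
  iseqv :=
    { refl a := by rw [tieOf_self, one_mul]
      symm h := by rwa [tieOf_comm]
      trans {a b d} hab hbd := by
        rcases eq_or_ne a b with rfl | h1
        · exact hbd
        rcases eq_or_ne b d with rfl | h2
        · exact hab
        rcases eq_or_ne a d with rfl | h3
        · rw [tieOf_self, one_mul]
        -- `t_{ad} x = t_{ad} t_{ab} x = t_{ab} t_{ad} x = t_{ab} t_{bd} x = t_{ab} x = x`.
        rw [← hab, ← mul_assoc, (H.commute_tieOf _ _ _ _).eq,
          ← (H.tieOf_mul_tieOf h1 h2 h3).1, mul_assoc, hbd] }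

end IsTieSystem

end Arc

/-! ### Roots of type A as differences of coordinate vectors. -/

section TypeA

variable {m : ℕ}

/-- The linear map sending the simple root `α_i` to `ε_i - ε_{i+1}`. -/
def rootMap (m : ℕ) : GeomSpace (Fin m) →ₗ[ℝ] (Fin (m + 1) →₀ ℝ) :=
  Finsupp.linearCombination ℝ fun i => Finsupp.single i.castSucc 1 - Finsupp.single i.succ 1

theorem rootMap_simpleRoot (i : Fin m) :
    rootMap m (simpleRoot i) = Finsupp.single i.castSucc 1 - Finsupp.single i.succ 1 := by
  simp [rootMap, simpleRoot]

/-- By linearity it suffices to check simple roots, where cos(π / m_{ij}) is -1, 1/2 or 0 according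
as j equals i, is adjacent to i, or is further away. Injectivity of `rootMap` plays no role. -/
theorem rootMap_simpleRefl (i : Fin m) (x : GeomSpace (Fin m)) :
    rootMap m (simpleRefl (CoxeterMatrix.A m) i x) =
      Finsupp.mapDomain (Equiv.swap i.castSucc i.succ) (rootMap m x) := by
  have key : rootMap m ∘ₗ (simpleRefl (CoxeterMatrix.A m) i).toLinearMap =
      Finsupp.lmapDomain ℝ ℝ (Equiv.swap i.castSucc i.succ) ∘ₗ rootMap m := by
    refine Finsupp.lhom_ext' fun j => LinearMap.ext_ring ?_
    change rootMap m (simpleRefl (CoxeterMatrix.A m) i (simpleRoot j)) =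
      Finsupp.mapDomain (Equiv.swap i.castSucc i.succ) (rootMap m (simpleRoot j))
    rw [simpleRefl_apply, refl_apply, map_sub, map_smul, geomForm_simple, rootMap_simpleRoot,
      rootMap_simpleRoot, sub_eq_add_neg (Finsupp.single j.castSucc (1 : ℝ)), Finsupp.mapDomain_add,
      ← Finsupp.single_neg, Finsupp.mapDomain_single, Finsupp.mapDomain_single]
    have fixed {a : Fin (m + 1)} (h1 : (a : ℕ) ≠ i) (h2 : (a : ℕ) ≠ i + 1) :
        Equiv.swap i.castSucc i.succ a = a :=
      Equiv.swap_apply_of_ne_of_ne (fun h => h1 (by simp [h])) (fun h => h2 (by simp [h]))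
    by_cases hij : i = j
    · subst hij
      rw [CoxeterMatrix.diagonal, Equiv.swap_apply_left, Equiv.swap_apply_right]
      simp only [Finsupp.single_neg, Nat.cast_one, div_one, Real.cos_pi]
      module
    have hij' : (j : ℕ) ≠ i := fun h => hij (Fin.ext h.symm)
    by_cases h1 : (i : ℕ) + 1 = j
    · have hM : CoxeterMatrix.A m i j = 3 := by
        simp [CoxeterMatrix.A, hij, h1]
      have e1 : j.castSucc = i.succ := Fin.ext (by simp [h1])
      rw [hM, e1, Equiv.swap_apply_right, fixed (by simp; omega) (by simp; omega)]
      simp only [Finsupp.single_neg, Nat.cast_ofNat, Real.cos_pi_div_three]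
      module
    by_cases h2 : (j : ℕ) + 1 = i
    · have hM : CoxeterMatrix.A m i j = 3 := by
        simp [CoxeterMatrix.A, hij, h2]
      have e1 : j.succ = i.castSucc := Fin.ext (by simp [h2])
      rw [hM, e1, Equiv.swap_apply_left, fixed (by simp; omega) (by simp; omega)]
      simp only [Finsupp.single_neg, Nat.cast_ofNat, Real.cos_pi_div_three]
      module
    have hM : CoxeterMatrix.A m i j = 2 := by
      simp [CoxeterMatrix.A, hij, h1, h2]
    rw [hM, fixed (by simp; omega) (by simp; omega), fixed (by simp; omega) (by simp; omega)]
    simp only [Finsupp.single_neg, Nat.cast_ofNat, Real.cos_pi_div_two]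
    module
  exact LinearMap.congr_fun key x

variable {G X : Type*} [Group G] [Monoid X] [MulDistribMulAction G X] {c : ℕ → G} {e : ℕ → X}
  {W : Type*} [Group W] (cs : CoxeterSystem (CoxeterMatrix.A m) W)

/-- An element of the Artin group acts compatibly on roots and on ties, through one permutation. -/
theorem IsTieSystem.exists_perm (H : IsTieSystem m c e) (φ : ArtinGroup (CoxeterMatrix.A m) →* G)
    (hφ : ∀ i, φ (artinGen _ i) = c i) (b : ArtinGroup (CoxeterMatrix.A m)) :
    ∃ σ : Equiv.Perm (Fin (m + 1)),
      (∀ x, rootMap m (geomRep cs (artinProj cs b) x) = Finsupp.mapDomain σ (rootMap m x)) ∧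
      ∀ a b', φ b • tieOf c e a b' = tieOf c e (σ a) (σ b') := by
  have hb : b ∈ Subgroup.closure (Set.range (artinGen (CoxeterMatrix.A m))) := by
    have : Subgroup.closure (Set.range (artinGen (CoxeterMatrix.A m))) = ⊤ :=
      PresentedGroup.closure_range_of _
    rw [this]; trivial
  induction hb using Subgroup.closure_induction with
  | mem x hx =>
    obtain ⟨i, rfl⟩ := hx
    refine ⟨Equiv.swap i.castSucc i.succ, fun x => ?_, ?_⟩
    · rw [artinProj_gen, geomRep_simple, rootMap_simpleRefl]
    · rw [hφ]; exact H.smul_tieOf i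
  | one => exact ⟨1, fun x => by simp [Finsupp.mapDomain_id, Equiv.Perm.coe_one], by simp⟩
  | mul x y _ _ hx hy =>
    obtain ⟨σ, h1, h2⟩ := hx
    obtain ⟨τ, h3, h4⟩ := hy
    refine ⟨σ * τ, fun z => ?_, fun a b => ?_⟩
    · rw [map_mul, map_mul, LinearEquiv.mul_apply, h1, h3, Equiv.Perm.coe_mul,
        Finsupp.mapDomain_comp]
    · rw [map_mul, mul_smul, h4, h2]; rfl
  | inv x _ hx =>
    obtain ⟨σ, h1, h2⟩ := hx
    refine ⟨σ⁻¹, fun z => ?_, fun a b => ?_⟩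
    · have := h1 (geomRep cs (artinProj cs x⁻¹) z)
      rw [← LinearEquiv.mul_apply, ← map_mul, ← map_mul, mul_inv_cancel, map_one, map_one,
        LinearEquiv.coe_one, id] at this
      rw [this, ← Finsupp.mapDomain_comp, ← Equiv.Perm.coe_mul, inv_mul_cancel, Equiv.Perm.coe_one,
        Finsupp.mapDomain_id]
    · rw [map_inv, inv_smul_eq_iff, h2]; simp

theorem artinProj_surjective : Function.Surjective (artinProj cs) := by
  intro w
  induction w using cs.simple_induction with
  | simple i => exact ⟨_, artinProj_gen cs i⟩
  | one => exact ⟨1, map_one _⟩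
  | mul w w' h h' =>
    obtain ⟨b, rfl⟩ := h
    obtain ⟨b', rfl⟩ := h'
    exact ⟨b * b', map_mul _ _ _⟩

end TypeA

/-! ### From root subsystems to products of ties: well-definedness by absorption. -/

section TieHom

variable {m : ℕ} {G X : Type*} [Group G] [Monoid X] [MulDistribMulAction G X] {c : ℕ → G}
  {e : ℕ → X} {W : Type*} [Group W] (cs : CoxeterSystem (CoxeterMatrix.A m) W)
  (φ : ArtinGroup (CoxeterMatrix.A m) →* G)

/-- The root subsystem generated by the transported simple roots listed in `l`. -/
def tieSubsystem (l : List (ArtinGroup (CoxeterMatrix.A m) × Fin m)) : RootSubsystem cs :=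
  (l.map fun p => artinProj cs p.1 • RootSubsystem.ofSimple cs p.2).prod

variable (e) in
/-- The product of the transported ties listed in `l`. -/
def tieProd (l : List (ArtinGroup (CoxeterMatrix.A m) × Fin m)) : X :=
  (l.map fun p => φ p.1 • e p.2).prod

namespace IsTieSystem

variable (H : IsTieSystem m c e)
include H

/-- The root subsystem of all roots joining indices whose tie is absorbed by `x`. -/
def absorbSubsystem (x : X) : RootSubsystem cs where
  carrier := roots cs ∩
    {v | Finsupp.mapDomain (Quotient.mk (H.absorbSetoid x)) (rootMap m v) = 0}
  subset_roots := Set.inter_subset_left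
  refl_mem v hv y hy := by
    refine ⟨refl_mem_roots cs hv.1 hy.1, ?_⟩
    -- The second condition is the kernel of a linear map, and the reflection of y in v is a linear
    -- combination of y and v.
    have h1 : Finsupp.lmapDomain ℝ ℝ (Quotient.mk (H.absorbSetoid x)) (rootMap m v) = 0 := hv.2
    have h2 : Finsupp.lmapDomain ℝ ℝ (Quotient.mk (H.absorbSetoid x)) (rootMap m y) = 0 := hy.2
    change Finsupp.lmapDomain ℝ ℝ (Quotient.mk (H.absorbSetoid x)) (rootMap m _) = 0
    rw [refl_apply, map_sub, map_smul, map_sub, map_smul, h1, h2, smul_zero, sub_zero]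

/-- If b acts through the permutation σ, the transported root is the difference of the coordinate
vectors at the images under σ of i and i + 1. It dies in the quotient exactly when these images are
equivalent, and the tie joining them is `φ b • e_i`. -/
theorem smul_ofSimple_subset_iff (hφ : ∀ i, φ (artinGen _ i) = c i)
    (b : ArtinGroup (CoxeterMatrix.A m)) (i : Fin m) (x : X) :
    (artinProj cs b • RootSubsystem.ofSimple cs i).carrier ⊆ (H.absorbSubsystem cs x).carrier ↔
      (φ b • e i) * x = x := by
  obtain ⟨σ, h1, h2⟩ := H.exists_perm cs φ hφ b
  have h3 : simpleRoot i ∈ ((artinProj cs b)⁻¹ • H.absorbSubsystem cs x).carrier ↔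
      geomRep cs (artinProj cs b) (simpleRoot i) ∈ (H.absorbSubsystem cs x).carrier := by
    rw [RootSubsystem.smul_carrier, map_inv]
    exact ⟨fun ⟨y, hy, hyi⟩ => by rw [← hyi]; simpa using hy, fun h => ⟨_, h, by simp⟩⟩
  rw [RootSubsystem.smul_subset_iff, RootSubsystem.ofSimple_subset_iff, h3,
    ← tieOf_castSucc_succ (c := c) (e := e), h2]
  have h4 : geomRep cs (artinProj cs b) (simpleRoot i) ∈ roots cs := ⟨_, i, rfl⟩
  change (_ ∧ Finsupp.mapDomain _ _ = 0) ↔ _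
  rw [h1, rootMap_simpleRoot, sub_eq_add_neg, ← Finsupp.single_neg, Finsupp.mapDomain_add,
    Finsupp.mapDomain_single, Finsupp.mapDomain_single, Finsupp.mapDomain_add,
    Finsupp.mapDomain_single, Finsupp.mapDomain_single, Finsupp.single_neg, ← sub_eq_add_neg,
    sub_eq_zero, Finsupp.single_left_inj one_ne_zero, Quotient.eq, and_iff_right h4]
  rfl

theorem tieProd_mul_of_subset (hφ : ∀ i, φ (artinGen _ i) = c i) {x : X}
    {l : List (ArtinGroup (CoxeterMatrix.A m) × Fin m)}
    (h : (tieSubsystem cs l).carrier ⊆ (H.absorbSubsystem cs x).carrier) :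
    tieProd e φ l * x = x := by
  induction l with
  | nil => simp [tieProd]
  | cons p l ih =>
    simp only [tieSubsystem, List.map_cons, List.prod_cons, RootSubsystem.mul_subset_iff] at h
    have h1 := ih h.2
    have h2 := (H.smul_ofSimple_subset_iff cs φ hφ _ _ _).mp h.1
    simp only [tieProd, List.map_cons, List.prod_cons] at h1 ⊢
    rw [mul_assoc, h1, h2]

theorem commute_smul (hφ : ∀ i, φ (artinGen _ i) = c i)
    (p p' : ArtinGroup (CoxeterMatrix.A m) × Fin m) :
    Commute (φ p.1 • e p.2) (φ p'.1 • e p'.2) := by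
  -- Only the action on ties is used, so any Coxeter system of type A serves; the canonical one is
  -- taken.
  obtain ⟨σ, -, h⟩ := H.exists_perm (CoxeterMatrix.A m).toCoxeterSystem φ hφ p.1
  obtain ⟨τ, -, h'⟩ := H.exists_perm (CoxeterMatrix.A m).toCoxeterSystem φ hφ p'.1
  rw [← tieOf_castSucc_succ (c := c) (e := e), h, ← tieOf_castSucc_succ (c := c) (e := e), h']
  exact H.commute_tieOf _ _ _ _

theorem commute_tieProd (hφ : ∀ i, φ (artinGen _ i) = c i)
    (l l' : List (ArtinGroup (CoxeterMatrix.A m) × Fin m)) :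
    Commute (tieProd e φ l) (tieProd e φ l') := by
  refine Commute.list_prod_left _ _ fun x hx => Commute.list_prod_right _ _ fun y hy => ?_
  obtain ⟨p, -, rfl⟩ := List.mem_map.mp hx
  obtain ⟨p', -, rfl⟩ := List.mem_map.mp hy
  exact H.commute_smul φ hφ p p'

theorem smul_mul_tieProd (hφ : ∀ i, φ (artinGen _ i) = c i)
    {p : ArtinGroup (CoxeterMatrix.A m) × Fin m}
    {l : List (ArtinGroup (CoxeterMatrix.A m) × Fin m)} (hp : p ∈ l) :
    (φ p.1 • e p.2) * tieProd e φ l = tieProd e φ l := by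
  induction l with
  | nil => simp at hp
  | cons p' l ih =>
    have hcons : tieProd e φ (p' :: l) = (φ p'.1 • e p'.2) * tieProd e φ l := by simp [tieProd]
    rw [hcons]
    rcases List.mem_cons.mp hp with rfl | hp
    · rw [← mul_assoc, ← smul_mul', H.idem _ p.2.2]
    · rw [← mul_assoc, (H.commute_smul φ hφ p p').eq, mul_assoc, ih hp]

theorem tieSubsystem_subset (hφ : ∀ i, φ (artinGen _ i) = c i)
    (l : List (ArtinGroup (CoxeterMatrix.A m) × Fin m)) :
    (tieSubsystem cs l).carrier ⊆ (H.absorbSubsystem cs (tieProd e φ l)).carrier := by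
  -- The absorbing element must remain the product over all of l while the induction shortens the
  -- list.
  have key : ∀ l' ⊆ l, (tieSubsystem cs l').carrier ⊆
      (H.absorbSubsystem cs (tieProd e φ l)).carrier := by
    intro l' hl'
    induction l' with
    | nil => exact Set.empty_subset _
    | cons p l' ih =>
      simp only [tieSubsystem, List.map_cons, List.prod_cons, RootSubsystem.mul_subset_iff]
      exact ⟨(H.smul_ofSimple_subset_iff cs φ hφ _ _ _).mpr
        (H.smul_mul_tieProd φ hφ (hl' List.mem_cons_self)),
        ih fun x hx => hl' (List.mem_cons_of_mem _ hx)⟩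
  exact key l (List.Subset.refl l)

/-- Each product absorbs its own factors, so its absorbing subsystem contains the subsystem of its
list, hence also that of the other list. The two products therefore absorb each other, and they
commute. -/
theorem tieProd_congr (hφ : ∀ i, φ (artinGen _ i) = c i)
    {l l' : List (ArtinGroup (CoxeterMatrix.A m) × Fin m)}
    (h : tieSubsystem cs l = tieSubsystem cs l') : tieProd e φ l = tieProd e φ l' := by
  have h1 : tieProd e φ l * tieProd e φ l' = tieProd e φ l' :=
    H.tieProd_mul_of_subset cs φ hφ (h ▸ H.tieSubsystem_subset cs φ hφ l')
  have h2 : tieProd e φ l' * tieProd e φ l = tieProd e φ l :=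
    H.tieProd_mul_of_subset cs φ hφ (h ▸ H.tieSubsystem_subset cs φ hφ l)
  exact h2.symm.trans ((H.commute_tieProd φ hφ l' l).eq.trans h1)

omit H in
theorem exists_tieSubsystem_eq (x : (JuyumayaMap.identity cs).ties) :
    ∃ l, tieSubsystem cs l = x := by
  obtain ⟨x, hx⟩ := x
  induction hx using Submonoid.closure_induction with
  | mem x hx =>
    obtain ⟨w, i, rfl⟩ := hx
    obtain ⟨b, rfl⟩ := artinProj_surjective cs w
    exact ⟨[(b, i)], by simp [tieSubsystem]; rfl⟩
  | one => exact ⟨[], rfl⟩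
  | mul x y _ _ hx hy =>
    obtain ⟨l, hl⟩ := hx
    obtain ⟨l', hl'⟩ := hy
    refine ⟨l ++ l', ?_⟩
    change _ = x * y
    rw [← show tieSubsystem cs l = x from hl, ← show tieSubsystem cs l' = y from hl']
    simp [tieSubsystem]

/-- A tie system receives an equivariant homomorphism from the monoid of root subsystems generated
by the `⟨α_i⟩`. -/
theorem exists_monoidHom (hφ : ∀ i, φ (artinGen _ i) = c i) :
    ∃ F : (JuyumayaMap.identity cs).ties →* X,
      (∀ i : Fin m, F ((JuyumayaMap.identity cs).tie' i) = e i) ∧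
      ∀ b x, F ((JuyumayaMap.identity cs).tiesAction (artinProj cs b) x) = φ b • F x := by
  -- F is defined through an arbitrary word for each subsystem; by `key`, any other word gives the
  -- same value, so each property is checked on a convenient word.
  choose l hl using exists_tieSubsystem_eq cs
  have key (x : (JuyumayaMap.identity cs).ties) (l' : List _) (h : tieSubsystem cs l' = x) :
      tieProd e φ (l x) = tieProd e φ l' := H.tieProd_congr cs φ hφ ((hl x).trans h.symm)
  refine ⟨⟨⟨fun x => tieProd e φ (l x), key 1 [] rfl⟩, fun x y => ?_⟩, fun i => ?_, fun b x => ?_⟩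
  · refine (key _ (l x ++ l y) ?_).trans (by simp [tieProd])
    rw [Submonoid.coe_mul, ← hl x, ← hl y]
    simp [tieSubsystem]
  · refine (key _ [(1, i)] ?_).trans (by simp [tieProd])
    simp [tieSubsystem]; rfl
  · refine (key _ ((l x).map fun p => (b * p.1, p.2)) ?_).trans ?_
    · change _ = artinProj cs b • (x : RootSubsystem cs)
      rw [← hl x, tieSubsystem, tieSubsystem, List.smul_prod', List.map_map, List.map_map]
      simp [Function.comp_def, mul_smul]
    · change _ = φ b • tieProd e φ (l x)
      rw [tieProd, tieProd, List.smul_prod', List.map_map, List.map_map]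
      simp [Function.comp_def, mul_smul]

end IsTieSystem

end TieHom

/-! ### Braid relations of type A and constancy of the parameter. -/

section ArtinA

variable {m : ℕ}

theorem typeA_apply_of_idxDist_eq_one {i j : Fin m} (h : idxDist i j = 1) :
    CoxeterMatrix.A m i j = 3 := by
  have h' : (j : ℕ) + 1 = i ∨ (i : ℕ) + 1 = j := by
    rw [idxDist, abs_eq one_pos.le] at h; omega
  have hij : i ≠ j := by rintro rfl; omega
  simp [CoxeterMatrix.A, hij, h']

theorem typeA_apply_of_one_lt_idxDist {i j : Fin m} (h : 1 < idxDist i j) :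
    CoxeterMatrix.A m i j = 2 := by
  rw [idxDist, lt_abs] at h
  have h' : ¬((j : ℕ) + 1 = i ∨ (i : ℕ) + 1 = j) := by omega
  have hij : i ≠ j := by rintro rfl; omega
  simp [CoxeterMatrix.A, hij, h']

theorem idxDist_comm (i j : Fin m) : idxDist i j = idxDist j i := abs_sub_comm _ _

theorem idxDist_trichotomy (i j : Fin m) : i = j ∨ idxDist i j = 1 ∨ 1 < idxDist i j := by
  by_cases h : i = j
  · exact Or.inl h
  have : (i : ℕ) ≠ j := fun h' => h (Fin.ext h')
  have h0 : 0 < idxDist i j := abs_pos.mpr (by omega)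
  omega

theorem artinGen_braidWord {B : Type*} (M : CoxeterMatrix B) (i j : B) :
    ((CoxeterSystem.braidWord M i j).map (artinGen M)).prod =
      ((CoxeterSystem.braidWord M j i).map (artinGen M)).prod := by
  have h := PresentedGroup.one_of_mem (rels := {r : FreeGroup B | ∃ i j : B,
    r = ((CoxeterSystem.braidWord M i j).map FreeGroup.of).prod *
      (((CoxeterSystem.braidWord M j i).map FreeGroup.of).prod)⁻¹}) ⟨i, j, rfl⟩
  rw [map_mul, map_inv, mul_inv_eq_one, map_list_prod, map_list_prod, List.map_map,
    List.map_map] at h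
  exact h

theorem artinGen_comm {i j : Fin m} (h : 1 < idxDist i j) :
    artinGen (CoxeterMatrix.A m) i * artinGen _ j = artinGen _ j * artinGen _ i := by
  have := artinGen_braidWord (CoxeterMatrix.A m) i j
  rw [CoxeterSystem.braidWord, CoxeterSystem.braidWord, typeA_apply_of_one_lt_idxDist h,
    typeA_apply_of_one_lt_idxDist (idxDist_comm i j ▸ h)] at this
  simpa [CoxeterSystem.alternatingWord] using this

theorem artinGen_braid {i j : Fin m} (h : idxDist i j = 1) :
    artinGen (CoxeterMatrix.A m) i * artinGen _ j * artinGen _ i =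
      artinGen _ j * artinGen _ i * artinGen _ j := by
  have := artinGen_braidWord (CoxeterMatrix.A m) j i
  rw [CoxeterSystem.braidWord, CoxeterSystem.braidWord, typeA_apply_of_idxDist_eq_one h,
    typeA_apply_of_idxDist_eq_one (idxDist_comm i j ▸ h)] at this
  simpa [CoxeterSystem.alternatingWord, mul_assoc] using this

/-- There is a homomorphism from the braid group of type `A` given by elements that satisfy the braid
relations. -/
theorem exists_artinLift {H : Type*} [Group H] (f : Fin m → H)
    (hcomm : ∀ i j, 1 < idxDist i j → f i * f j = f j * f i)
    (hbraid : ∀ i j, idxDist i j = 1 → f i * f j * f i = f j * f i * f j) :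
    ∃ φ : ArtinGroup (CoxeterMatrix.A m) →* H, ∀ i, φ (artinGen _ i) = f i := by
  refine ⟨PresentedGroup.toGroup (f := f) ?_, fun i => PresentedGroup.toGroup.of _⟩
  rintro r ⟨i, j, rfl⟩
  rw [map_mul, map_inv, mul_inv_eq_one, map_list_prod, map_list_prod, List.map_map, List.map_map]
  rcases idxDist_trichotomy i j with rfl | h | h
  · rfl
  · rw [CoxeterSystem.braidWord, CoxeterSystem.braidWord, typeA_apply_of_idxDist_eq_one h,
      typeA_apply_of_idxDist_eq_one (idxDist_comm i j ▸ h)]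
    simpa [CoxeterSystem.alternatingWord, mul_assoc] using (hbraid i j h).symm
  · rw [CoxeterSystem.braidWord, CoxeterSystem.braidWord, typeA_apply_of_one_lt_idxDist h,
      typeA_apply_of_one_lt_idxDist (idxDist_comm i j ▸ h)]
    simpa [CoxeterSystem.alternatingWord] using hcomm i j h

variable {W : Type*} [Group W] (cs : CoxeterSystem (CoxeterMatrix.A m) W)

theorem simple_comm {i j : Fin m} (h : 1 < idxDist i j) :
    cs.simple i * cs.simple j = cs.simple j * cs.simple i := by
  simpa only [map_mul, artinProj_gen] using congrArg (artinProj cs) (artinGen_comm h)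

theorem simple_braid {i j : Fin m} (h : idxDist i j = 1) :
    cs.simple i * cs.simple j * cs.simple i = cs.simple j * cs.simple i * cs.simple j := by
  simpa only [map_mul, artinProj_gen] using congrArg (artinProj cs) (artinGen_braid h)

theorem simple_conj {i j : Fin m} (h : idxDist i j = 1) :
    (cs.simple i * cs.simple j) * cs.simple i * (cs.simple i * cs.simple j)⁻¹ = cs.simple j := by
  rw [simple_braid cs h]; group

theorem ConjInvariant.exists_eq {X : Type*} [Nonempty X] {u : Fin m → X}
    (hu : ConjInvariant cs u) : ∃ q, ∀ i, u i = q := by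
  rcases m with _ | m
  -- Without generators every value qualifies, which is where nonemptiness of X enters.
  · exact ⟨Classical.arbitrary X, fun i => i.elim0⟩
  refine ⟨u 0, fun i => ?_⟩
  induction i using Fin.induction with
  | zero => rfl
  | succ i ih =>
    rw [← ih]
    exact (hu _ _ _ (simple_conj cs (by simp [idxDist]))).symm

end ArtinA

/-! ### The algebra of braids and ties under conjugation by its units. -/

namespace BTAlgebra

variable {R : Type*} [CommRing R] {n : ℕ} (q : R)

theorem g_mul_g {i j : Fin (n - 1)} (h : 1 < idxDist i j) : g q i * g q j = g q j * g q i := by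
  simpa only [map_mul, g, e] using RingQuot.mkAlgHom_rel R (BTRel.gg (q := q) i j h)

theorem g_mul_g_mul_g {i j : Fin (n - 1)} (h : idxDist i j = 1) :
    g q i * g q j * g q i = g q j * g q i * g q j := by
  simpa only [map_mul, g, e] using RingQuot.mkAlgHom_rel R (BTRel.ggg (q := q) i j h)

theorem g_sq (i : Fin (n - 1)) : g q i ^ 2 = 1 + (q - 1) • (e q i * (1 - g q i)) := by
  simpa only [map_mul, map_pow, map_add, map_sub, map_smul, map_one, g, e] using
    RingQuot.mkAlgHom_rel R (BTRel.quadratic (q := q) i)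

theorem g_mul_e {i j : Fin (n - 1)} (h : idxDist i j ≠ 1) : g q i * e q j = e q j * g q i := by
  simpa only [map_mul, g, e] using RingQuot.mkAlgHom_rel R (BTRel.ge (q := q) i j h)

theorem g_mul_g_mul_e {i j : Fin (n - 1)} (h : idxDist i j = 1) :
    g q j * g q i * e q j = e q i * g q j * g q i := by
  simpa only [map_mul, g, e] using RingQuot.mkAlgHom_rel R (BTRel.gge (q := q) i j h)

theorem e_mul_e (i j : Fin (n - 1)) : e q i * e q j = e q j * e q i := by
  simpa only [map_mul, g, e] using RingQuot.mkAlgHom_rel R (BTRel.ee (q := q) i j)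

theorem e_sq (i : Fin (n - 1)) : e q i ^ 2 = e q i := by
  simpa only [map_pow, e] using RingQuot.mkAlgHom_rel R (BTRel.idem (q := q) i)

theorem e_mul_e_mul_g {i j : Fin (n - 1)} (h : idxDist i j = 1) :
    e q i * e q j * g q j = e q i * g q j * e q i := by
  simpa only [map_mul, g, e] using RingQuot.mkAlgHom_rel R (BTRel.eeg (q := q) i j h)

theorem e_mul_g_mul_e {i j : Fin (n - 1)} (h : idxDist i j = 1) :
    e q i * g q j * e q i = g q j * e q i * e q j := by
  simpa only [map_mul, g, e] using RingQuot.mkAlgHom_rel R (BTRel.ege (q := q) i j h)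

theorem idxDist_self {m : ℕ} (i : Fin m) : idxDist i i ≠ 1 := by simp [idxDist]

theorem g_mul_self (i : Fin (n - 1)) :
    g q i * g q i = 1 + (q - 1) • (e q i - e q i * g q i) := by
  rw [← pow_two, g_sq, mul_sub, mul_one]

/-- By the quadratic relation `g_j²` is a combination of 1, `e_j` and `e_j g_j`. The last commutes
with `e_i` by the two-sided relation `e_i e_j g_j = e_i g_j e_i = g_j e_i e_j`. -/
theorem g_sq_mul_e {i j : Fin (n - 1)} (h : idxDist i j = 1) :
    g q j * g q j * e q i = e q i * (g q j * g q j) := by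
  have h1 : e q j * g q j * e q i = e q i * (e q j * g q j) := by
    rw [← g_mul_e q (idxDist_self j), mul_assoc, e_mul_e q j i, ← mul_assoc, ← e_mul_g_mul_e q h,
      ← e_mul_e_mul_g q h, g_mul_e q (idxDist_self j), mul_assoc]
  rw [g_mul_self, add_mul, mul_add, smul_mul_assoc, mul_smul_comm, sub_mul, mul_sub, h1,
    e_mul_e q j i, one_mul, mul_one]

/-- The generators `g_i` are invertible. -/
def gUnit (q : Rˣ) (i : Fin (n - 1)) : (BTAlgebra R n (q : R))ˣ :=
  have hu : ((q⁻¹ : Rˣ) : R) * (q : R) = 1 := Units.inv_mul _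
  have hg := g_mul_self (q : R) i
  have hc := g_mul_e (q : R) (idxDist_self i)
  have he : e (q : R) i * e (q : R) i = e (q : R) i := by rw [← pow_two, e_sq]
  have heg : e (q : R) i * (e (q : R) i * g (q : R) i) = e (q : R) i * g (q : R) i := by
    rw [← mul_assoc, he]
  have h1 : g (q : R) i * (e (q : R) i * g (q : R) i) =
      (q : R) • e (q : R) i - ((q : R) - 1) • (e (q : R) i * g (q : R) i) := by
    rw [← mul_assoc, hc, mul_assoc, hg, mul_add, mul_one, mul_smul_comm, mul_sub, he, heg]
    module
  have h2 : e (q : R) i * g (q : R) i * g (q : R) i =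
      (q : R) • e (q : R) i - ((q : R) - 1) • (e (q : R) i * g (q : R) i) := by
    rw [← h1, ← mul_assoc, hc]
  { val := g (q : R) i
    -- Split along the idempotent `e_i`: on 1 - e the square of g is 1 and the inverse is g; on e
    -- one has `g² = q - (q - 1) g` and the inverse is `q⁻¹ g + 1 - q⁻¹`.
    inv := g (q : R) i + ((q⁻¹ : Rˣ) - 1 : R) • (e (q : R) i * g (q : R) i) +
      (1 - (q⁻¹ : Rˣ) : R) • e (q : R) i
    val_inv := by
      rw [mul_add, mul_add, mul_smul_comm, mul_smul_comm, h1, hg, hc]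
      match_scalars
      · ring
      · linear_combination hu
      · linear_combination -hu
    inv_val := by
      rw [add_mul, add_mul, smul_mul_assoc, smul_mul_assoc, h2, hg]
      match_scalars
      · ring
      · linear_combination hu
      · linear_combination -hu }

theorem val_gUnit (q : Rˣ) (i : Fin (n - 1)) : (gUnit q i : BTAlgebra R n (q : R)) = g (q : R) i :=
  rfl

open ConjAct in
/-- The conjugation by `g_i`, with indices extended to all natural numbers. -/
def conjG (n : ℕ) (q : Rˣ) (k : ℕ) : ConjAct (BTAlgebra R n (q : R))ˣ :=
  -- The value 1 out of range is harmless: every axiom of `IsTieSystem` bounds its indices.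
  if h : k < n - 1 then toConjAct (gUnit q ⟨k, h⟩) else 1

/-- The tie `e_i`, with indices extended to all natural numbers. -/
def natE (n : ℕ) (q : R) (k : ℕ) : BTAlgebra R n q :=
  if h : k < n - 1 then e q ⟨k, h⟩ else 1

/-- Rewrites statements about conjugation without inverses, in the shape of the defining relations.
-/
theorem conj_smul_eq_iff (q : Rˣ) (x : (BTAlgebra R n (q : R))ˣ) (y z : BTAlgebra R n (q : R)) :
    ConjAct.toConjAct x • y = z ↔ x * y = z * x := by
  rw [ConjAct.units_smul_def, ConjAct.ofConjAct_toConjAct, Units.mul_inv_eq_iff_eq_mul]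

/-- Every axiom is a defining relation read as a statement about conjugation, except `sq_succ`,
which is `g_sq_mul_e`. -/
theorem isTieSystem (n : ℕ) (q : Rˣ) : IsTieSystem (n - 1) (conjG n q) (natE n (q : R)) where
  comm i j hij hj := by
    have h : 1 < idxDist (⟨i, by omega⟩ : Fin (n - 1)) ⟨j, hj⟩ := by
      simp only [idxDist, lt_abs]; omega
    simp only [conjG, hj, show i < n - 1 by omega, dite_true, ← map_mul]
    exact congrArg _ (Units.ext (g_mul_g (q : R) h))
  braid i hi := by
    have h : idxDist (⟨i, by omega⟩ : Fin (n - 1)) ⟨i + 1, hi⟩ = 1 := by simp [idxDist]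
    simp only [conjG, hi, show i < n - 1 by omega, dite_true, ← map_mul]
    exact congrArg _ (Units.ext (g_mul_g_mul_g (q : R) h))
  fix i j hi hj h1 h2 := by
    have h : idxDist (⟨i, hi⟩ : Fin (n - 1)) ⟨j, hj⟩ ≠ 1 := by
      simp only [idxDist, ne_eq, abs_eq (zero_le_one (α := ℤ))]; omega
    simp only [conjG, natE, hi, hj, dite_true]
    exact (conj_smul_eq_iff _ _ _ _).mpr (g_mul_e (q : R) h)
  move_succ i hi := by
    have h : idxDist (⟨i + 1, hi⟩ : Fin (n - 1)) ⟨i, by omega⟩ = 1 := by simp [idxDist]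
    simp only [conjG, natE, hi, show i < n - 1 by omega, dite_true, ← mul_smul, ← map_mul]
    refine (conj_smul_eq_iff _ _ _ _).mpr ?_
    rw [Units.val_mul, ← mul_assoc]
    exact g_mul_g_mul_e (q : R) h
  move_pred i hi := by
    have h : idxDist (⟨i, by omega⟩ : Fin (n - 1)) ⟨i + 1, hi⟩ = 1 := by simp [idxDist]
    simp only [conjG, natE, hi, show i < n - 1 by omega, dite_true, ← mul_smul, ← map_mul]
    refine (conj_smul_eq_iff _ _ _ _).mpr ?_
    rw [Units.val_mul, ← mul_assoc]
    exact g_mul_g_mul_e (q : R) h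
  sq_succ i hi := by
    have h : idxDist (⟨i, by omega⟩ : Fin (n - 1)) ⟨i + 1, hi⟩ = 1 := by simp [idxDist]
    simp only [conjG, natE, hi, show i < n - 1 by omega, dite_true, ← mul_smul, ← map_mul]
    exact (conj_smul_eq_iff _ _ _ _).mpr (g_sq_mul_e (q : R) h)
  idem i hi := by
    simp only [natE, hi, dite_true, ← pow_two, e_sq]
  tie_comm i j hij hj := by
    simp only [natE, hj, show i < n - 1 by omega, dite_true]
    exact e_mul_e _ _ _
  tie i hi := by
    have h : idxDist (⟨i, by omega⟩ : Fin (n - 1)) ⟨i + 1, hi⟩ = 1 := by simp [idxDist]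
    simp only [conjG, natE, hi, show i < n - 1 by omega, dite_true]
    rw [ConjAct.units_smul_def, ConjAct.ofConjAct_toConjAct, ← mul_assoc,
      Units.eq_mul_inv_iff_mul_eq, ← mul_assoc]
    exact e_mul_e_mul_g (q : R) h

end BTAlgebra

/-! ### Commutation rules, generation and universal property of the Marin ring. -/

namespace MarinDatum

variable {B : Type*} {M : CoxeterMatrix B} {W : Type*} [Group W] {cs : CoxeterSystem M W}
  {k A : Type*} [CommRing k] [CommRing A] [Algebra k A] (D : MarinDatum cs k A)

/-- The homomorphism from the coefficient algebra to the Marin ring. -/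
def coeffHom : A →ₐ[k] D.MarinRing :=
  (RingQuot.mkAlgHom k D.Rel).comp
    { SkewMonoidAlgebra.singleOneRingHom (k := A) (G := D.Braid) with
      commutes' := fun r => by
        rw [SkewMonoidAlgebra.coe_algebraMap]; rfl }

/-- The homomorphism from the Artin group to the Marin ring. -/
def braidHom : D.Braid →* D.MarinRing :=
  (RingQuot.mkAlgHom k D.Rel : D.SemidirectProduct →* D.MarinRing).comp
    (SkewMonoidAlgebra.of A D.Braid)

theorem braidHom_gen (i : B) : D.braidHom (D.braidGen i) = D.gen i := rfl

theorem braidHom_mul_coeff (b : D.Braid) (c : A) :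
    D.braidHom b * D.coeffHom c = D.coeffHom (D.ρ (D.proj b) c) * D.braidHom b := by
  change RingQuot.mkAlgHom k D.Rel (SkewMonoidAlgebra.single b 1) *
    RingQuot.mkAlgHom k D.Rel (SkewMonoidAlgebra.single 1 c) =
    RingQuot.mkAlgHom k D.Rel (SkewMonoidAlgebra.single 1 _) *
    RingQuot.mkAlgHom k D.Rel (SkewMonoidAlgebra.single b 1)
  rw [← map_mul, ← map_mul, SkewMonoidAlgebra.single_mul_single,
    SkewMonoidAlgebra.single_mul_single, one_mul, mul_one, one_mul, one_smul, mul_one, braid_smul]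

theorem gen_mul_coeff (i : B) (c : A) :
    D.gen i * D.coeffHom c = D.coeffHom (D.ρ (cs.simple i) c) * D.gen i := by
  have h : D.proj (D.braidGen i) = cs.simple i := artinProj_gen cs i
  rw [← braidHom_gen, braidHom_mul_coeff, h]

theorem gen_sq (i : B) : D.gen i ^ 2 =
    D.coeffHom (D.a i : A) + D.coeffHom (1 - (D.a i : A)) * D.gen i := by
  have h := RingQuot.mkAlgHom_rel k (Rel.quadratic (D := D) i)
  rw [map_sub, map_sub, map_zero, map_pow, map_mul, sub_sub, sub_eq_zero] at h
  exact h

/-- Every element of the semidirect product is a sum of terms c g. Hence algebra maps out of the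
Marin ring may be compared on coefficients and on braids. -/
theorem adjoin_eq_top :
    Algebra.adjoin k (Set.range D.coeffHom ∪ Set.range D.braidHom) = ⊤ := by
  refine eq_top_iff.mpr fun x _ => ?_
  obtain ⟨x, rfl⟩ := RingQuot.mkAlgHom_surjective k D.Rel x
  induction x using SkewMonoidAlgebra.induction_on with
  | zero => rw [map_zero]; exact zero_mem _
  | single g a =>
    have h : RingQuot.mkAlgHom k D.Rel (SkewMonoidAlgebra.single g a) =
        D.coeffHom a * D.braidHom g := by
      change _ = RingQuot.mkAlgHom k D.Rel (SkewMonoidAlgebra.single 1 a) *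
        RingQuot.mkAlgHom k D.Rel (SkewMonoidAlgebra.single g 1)
      rw [← map_mul, SkewMonoidAlgebra.single_mul_single, one_mul, one_smul, mul_one]
    rw [h]
    exact mul_mem (Algebra.subset_adjoin (Or.inl ⟨a, rfl⟩))
      (Algebra.subset_adjoin (Or.inr ⟨g, rfl⟩))
  | add x y hx hy => rw [map_add]; exact add_mem (hx trivial) (hy trivial)

/-- The universal property of the Marin ring. -/
theorem exists_lift {E : Type*} [Ring E] [Algebra k E] (f : A →ₐ[k] E) (φ : D.Braid →* E)
    (hcomm : ∀ b c, f (D.ρ (D.proj b) c) * φ b = φ b * f c)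
    (hquad : ∀ i, φ (D.braidGen i) ^ 2 = f (D.a i) + f (1 - D.a i) * φ (D.braidGen i)) :
    ∃ F : D.MarinRing →ₐ[k] E, (∀ c, F (D.coeffHom c) = f c) ∧ ∀ b, F (D.braidHom b) = φ b := by
  have hc : ∀ {b c}, f (c • b) * φ c = φ c * f b := fun {b c} => hcomm c b
  let L : D.SemidirectProduct →ₐ[k] E := SkewMonoidAlgebra.liftNCAlgHom f φ hc
  have hL (b : D.Braid) (c : A) : L (SkewMonoidAlgebra.single b c) = f c * φ b :=
    SkewMonoidAlgebra.liftNC_single _ _ _ _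
  have hrel : ∀ ⦃x y⦄, D.Rel x y → L x = L y := by
    rintro _ _ ⟨i⟩
    rw [map_sub, map_sub, map_zero, map_pow, map_mul, sgen, scoeff, scoeff, hL, hL, hL, map_one,
      map_one, one_mul, mul_one, mul_one, hquad]
    abel
  refine ⟨RingQuot.liftAlgHom k ⟨L, hrel⟩, fun c => ?_, fun b => ?_⟩
  · change RingQuot.liftAlgHom k ⟨L, hrel⟩ (RingQuot.mkAlgHom k D.Rel
      (SkewMonoidAlgebra.single 1 c)) = _
    rw [RingQuot.liftAlgHom_mkAlgHom_apply, hL, map_one, mul_one]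
  · change RingQuot.liftAlgHom k ⟨L, hrel⟩ (RingQuot.mkAlgHom k D.Rel
      (SkewMonoidAlgebra.single b 1)) = _
    rw [RingQuot.liftAlgHom_mkAlgHom_apply, hL, map_one, one_mul]

end MarinDatum

/-! ### How simple reflections act on the elements `e_s` of the monoid algebra. -/

section Identity

variable {R : Type*} [CommRing R]

section General

variable {B : Type*} {M : CoxeterMatrix B} {W : Type*} [Group W] (cs : CoxeterSystem M W)

theorem tiesAlgAction_of (w : W) (x : (JuyumayaMap.identity cs).ties) :
    (JuyumayaMap.identity cs).tiesAlgAction R w (MonoidAlgebra.of R _ x) =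
      MonoidAlgebra.of R _ ((JuyumayaMap.identity cs).tiesAction w x) := by
  simp [JuyumayaMap.tiesAlgAction]

theorem tiesAlgAction_tieElt {i j : B} {w : W} (h : w * cs.simple i * w⁻¹ = cs.simple j) :
    (JuyumayaMap.identity cs).tiesAlgAction R w ((JuyumayaMap.identity cs).tieElt i) =
      (JuyumayaMap.identity cs).tieElt j := by
  rw [JuyumayaMap.tieElt, tiesAlgAction_of]
  exact congrArg _ (Subtype.ext (RootSubsystem.smul_ofSimple h))

/-- A root subsystem containing `α_i` is stable under `s_i`. -/
theorem tieElt_mul_tiesAlgAction (i j : B) :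
    (JuyumayaMap.identity cs).tieElt i * (JuyumayaMap.identity cs).tiesAlgAction R (cs.simple i)
      ((JuyumayaMap.identity cs).tieElt j) =
      (JuyumayaMap.identity cs).tieElt i * (JuyumayaMap.identity cs).tieElt j := by
  rw [JuyumayaMap.tieElt, JuyumayaMap.tieElt, tiesAlgAction_of, ← map_mul, ← map_mul]
  exact congrArg _ (Subtype.ext (RootSubsystem.ofSimple_mul_smul i _).symm)

end General

variable {m : ℕ} {W : Type*} [Group W] (cs : CoxeterSystem (CoxeterMatrix.A m) W)

theorem tiesAlgAction_tieElt_of_idxDist_ne_one {i j : Fin m} (h : idxDist i j ≠ 1) :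
    (JuyumayaMap.identity cs).tiesAlgAction R (cs.simple i) ((JuyumayaMap.identity cs).tieElt j) =
      (JuyumayaMap.identity cs).tieElt j := by
  refine tiesAlgAction_tieElt cs ?_
  rcases idxDist_trichotomy i j with rfl | h' | h'
  · group
  · exact absurd h' h
  · rw [simple_comm cs h', mul_inv_cancel_right]

/-- Since `s_i s_j` conjugates `s_i` to `s_j`, `e_j = s_i s_j • e_i`; applying `s_i` cancels the
first factor. -/
theorem tiesAlgAction_tieElt_comm {i j : Fin m} (h : idxDist i j = 1) :
    (JuyumayaMap.identity cs).tiesAlgAction R (cs.simple i) ((JuyumayaMap.identity cs).tieElt j) =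
      (JuyumayaMap.identity cs).tiesAlgAction R (cs.simple j)
        ((JuyumayaMap.identity cs).tieElt i) := by
  rw [← tiesAlgAction_tieElt cs (simple_conj cs h), map_mul, AlgEquiv.mul_apply,
    ← AlgEquiv.mul_apply, ← map_mul, cs.simple_mul_simple_self, map_one, AlgEquiv.one_apply]

end Identity

/-! ### Maps out of the algebra of braids and ties. -/

namespace BTAlgebra

variable {R : Type*} [CommRing R] {n : ℕ}

/-- The universal property of the algebra of braids and ties. -/
theorem exists_lift {E : Type*} [Ring E] [Algebra R E] {q : R} (γ τ : Fin (n - 1) → E)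
    (gg : ∀ i j, 1 < idxDist i j → γ i * γ j = γ j * γ i)
    (ggg : ∀ i j, idxDist i j = 1 → γ i * γ j * γ i = γ j * γ i * γ j)
    (quad : ∀ i, γ i ^ 2 = 1 + (q - 1) • (τ i * (1 - γ i)))
    (ge : ∀ i j, idxDist i j ≠ 1 → γ i * τ j = τ j * γ i)
    (gge : ∀ i j, idxDist i j = 1 → γ j * γ i * τ j = τ i * γ j * γ i)
    (ee : ∀ i j, τ i * τ j = τ j * τ i) (idem : ∀ i, τ i ^ 2 = τ i)
    (eeg : ∀ i j, idxDist i j = 1 → τ i * τ j * γ j = τ i * γ j * τ i)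
    (ege : ∀ i j, idxDist i j = 1 → τ i * γ j * τ i = γ j * τ i * τ j) :
    ∃ f : BTAlgebra R n q →ₐ[R] E, (∀ i, f (g q i) = γ i) ∧ ∀ i, f (e q i) = τ i := by
  let L : FreeAlgebra R (BTGen n) →ₐ[R] E := FreeAlgebra.lift R fun
    | .g i => γ i
    | .e i => τ i
  have hg (i : Fin (n - 1)) : L (fg R n i) = γ i := FreeAlgebra.lift_ι_apply _ _
  have he (i : Fin (n - 1)) : L (fe R n i) = τ i := FreeAlgebra.lift_ι_apply _ _
  have hrel : ∀ ⦃x y⦄, BTRel R n q x y → L x = L y := by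
    intro x y h
    cases h <;> simp only [map_mul, map_pow, map_add, map_sub, map_smul, map_one, hg, he]
    case gg i j h => exact gg i j h
    case ggg i j h => exact ggg i j h
    case quadratic i => exact quad i
    case ge i j h => exact ge i j h
    case gge i j h => exact gge i j h
    case ee i j => exact ee i j
    case idem i => exact idem i
    case eeg i j h => exact eeg i j h
    case ege i j h => exact ege i j h
  refine ⟨RingQuot.liftAlgHom R ⟨L, hrel⟩, fun i => ?_, fun i => ?_⟩
  · rw [g, RingQuot.liftAlgHom_mkAlgHom_apply, hg]
  · rw [e, RingQuot.liftAlgHom_mkAlgHom_apply, he]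

theorem algHom_ext {E : Type*} [Ring E] [Algebra R E] {q : R} {f f' : BTAlgebra R n q →ₐ[R] E}
    (hg : ∀ i, f (g q i) = f' (g q i)) (he : ∀ i, f (e q i) = f' (e q i)) : f = f' := by
  refine RingQuot.ringQuot_ext' _ _ _ (FreeAlgebra.hom_ext (funext fun x => ?_))
  cases x with
  | g i => exact hg i
  | e i => exact he i

end BTAlgebra

/-! ### The two mutually inverse homomorphisms. -/

section MainTheorem

variable {R : Type*} [CommRing R] {n : ℕ} {W : Type*} [Group W]
  (cs : CoxeterSystem (CoxeterMatrix.A (n - 1)) W) (u : Fin (n - 1) → Rˣ)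
  (hu : ConjInvariant cs u)

theorem val_marinDatum_a {q : Rˣ} (hq : ∀ i, u i = q) (i : Fin (n - 1)) :
    (((JuyumayaMap.identity cs).marinDatum u hu).a i :
      MonoidAlgebra R (JuyumayaMap.identity cs).ties) =
      1 + ((q : R) - 1) • (JuyumayaMap.identity cs).tieElt i := by
  rw [← hq i]; rfl

/-- The relations of the algebra of braids and ties hold in the Marin ring. -/
theorem exists_algHom_marinRing {q : Rˣ} (hq : ∀ i, u i = q) :
    ∃ f : BTAlgebra R n (q : R) →ₐ[R] ((JuyumayaMap.identity cs).marinDatum u hu).MarinRing,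
      (∀ i, f (BTAlgebra.g (q : R) i) = ((JuyumayaMap.identity cs).marinDatum u hu).gen i) ∧
      ∀ i, f (BTAlgebra.e (q : R) i) = ((JuyumayaMap.identity cs).marinDatum u hu).coeffHom
        ((JuyumayaMap.identity cs).tieElt i) := by
  set D := (JuyumayaMap.identity cs).marinDatum u hu with hD
  have hρ (w : W) : D.ρ w = (JuyumayaMap.identity cs).tiesAlgAction R w := rfl
  have swap_tie {i j : Fin (n - 1)} (h : idxDist i j = 1) :
      (JuyumayaMap.identity cs).tieElt (R := R) i *
        (JuyumayaMap.identity cs).tiesAlgAction R (cs.simple j)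
          ((JuyumayaMap.identity cs).tieElt i) =
      (JuyumayaMap.identity cs).tieElt i * (JuyumayaMap.identity cs).tieElt j := by
    rw [← tiesAlgAction_tieElt_comm cs h, tieElt_mul_tiesAlgAction]
  have fixed {i j : Fin (n - 1)} (h : idxDist i j ≠ 1) :=
    tiesAlgAction_tieElt_of_idxDist_ne_one (R := R) cs h
  refine BTAlgebra.exists_lift _ _ ?_ ?_ ?_ ?_ ?_ ?_ ?_ ?_ ?_
  · intro i j h
    have : D.braidGen i * D.braidGen j = D.braidGen j * D.braidGen i := artinGen_comm h
    simpa only [map_mul, D.braidHom_gen] using congrArg D.braidHom this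
  · intro i j h
    have : D.braidGen i * D.braidGen j * D.braidGen i =
      D.braidGen j * D.braidGen i * D.braidGen j := artinGen_braid h
    simpa only [map_mul, D.braidHom_gen] using congrArg D.braidHom this
  · intro i
    rw [D.gen_sq, val_marinDatum_a cs u hu hq, map_sub, map_add, map_one, map_smul, sub_mul, one_mul,
      add_mul, smul_mul_assoc, mul_sub, mul_one, smul_sub, one_mul]
    abel
  · intro i j h
    rw [D.gen_mul_coeff, hρ, fixed h]
  · intro i j h
    rw [mul_assoc, D.gen_mul_coeff, ← mul_assoc, D.gen_mul_coeff, hρ, hρ,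
      tiesAlgAction_tieElt_comm cs h, ← AlgEquiv.mul_apply, ← map_mul, cs.simple_mul_simple_self,
      map_one, AlgEquiv.one_apply]
  · intro i j
    rw [← map_mul, ← map_mul, mul_comm]
  · intro i
    rw [pow_two, ← map_mul, JuyumayaMap.tieElt_mul_self]
  · intro i j h
    rw [mul_assoc _ (D.gen j), D.gen_mul_coeff, ← mul_assoc, ← map_mul, ← map_mul, hρ, swap_tie h]
  · intro i j h
    -- The product `e_i e_j` is invariant under `s_j`, so `g_j` commutes with it.
    have key : (JuyumayaMap.identity cs).tiesAlgAction R (cs.simple j)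
        ((JuyumayaMap.identity cs).tieElt i * (JuyumayaMap.identity cs).tieElt j) =
        (JuyumayaMap.identity cs).tieElt i * (JuyumayaMap.identity cs).tieElt j := by
      rw [map_mul, fixed (BTAlgebra.idxDist_self j), mul_comm, tieElt_mul_tiesAlgAction, mul_comm]
    rw [mul_assoc (D.gen j), ← map_mul, D.gen_mul_coeff j (_ * _), hρ, key, mul_assoc _ (D.gen j),
      D.gen_mul_coeff, ← mul_assoc, ← map_mul, hρ, swap_tie h]

open BTAlgebra in
/-- The homomorphism to the Marin ring is an isomorphism. -/
theorem exists_marinRing_equiv {q : Rˣ} (hq : ∀ i, u i = q) :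
    ∃ f : BTAlgebra R n (q : R) ≃ₐ[R] ((JuyumayaMap.identity cs).marinDatum u hu).MarinRing,
      (∀ i, f (BTAlgebra.g (q : R) i) = ((JuyumayaMap.identity cs).marinDatum u hu).gen i) ∧
      ∀ i, f (BTAlgebra.e (q : R) i) = ((JuyumayaMap.identity cs).marinDatum u hu).coeff
        ((JuyumayaMap.identity cs).tieElt i) := by
  have hf := exists_algHom_marinRing cs u hu hq
  have ha := val_marinDatum_a cs u hu hq
  have hρ (w : W) : ((JuyumayaMap.identity cs).marinDatum u hu).ρ w =
    (JuyumayaMap.identity cs).tiesAlgAction R w := rfl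
  generalize (JuyumayaMap.identity cs).marinDatum u hu = D at *
  obtain ⟨f, hfg, hfe⟩ := hf
  obtain ⟨φ, hφ⟩ := exists_artinLift (gUnit (n := n) q)
    (fun i j h => Units.ext (g_mul_g (q : R) h)) fun i j h => Units.ext (g_mul_g_mul_g (q : R) h)
  have hφc (i : Fin (n - 1)) :
      (ConjAct.toConjAct.toMonoidHom.comp φ) (artinGen _ i) = conjG n q i := by
    simp [hφ, conjG]
  obtain ⟨F, hFe, hFφ⟩ := (isTieSystem n q).exists_monoidHom cs _ hφc
  have hFe' (i : Fin (n - 1)) : F ((JuyumayaMap.identity cs).tie' i) = e (q : R) i := by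
    rw [hFe]; simp [natE]
  have hFφ' (b x) : F ((JuyumayaMap.identity cs).tiesAction (artinProj cs b) x) * φ b =
      φ b * F x := ((conj_smul_eq_iff q (φ b) _ _).mp (hFφ b x).symm).symm
  -- Both sides come from group homomorphisms into units, so agreement on Artin generators suffices.
  have hfφ (b : D.Braid) : f (φ b : (BTAlgebra R n (q : R))ˣ) = D.braidHom b := by
    have h : (Units.map (f : _ →* D.MarinRing)).comp φ =
        (D.braidHom.toHomUnits : ArtinGroup (CoxeterMatrix.A (n - 1)) →* D.MarinRingˣ) := by
      refine PresentedGroup.ext fun i => Units.ext ?_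
      change f (φ (artinGen _ i)) = D.braidHom (D.braidGen i)
      rw [hφ, val_gUnit, hfg, D.braidHom_gen]
    exact congrArg Units.val (DFunLike.congr_fun h b)
  have hfF (x : (JuyumayaMap.identity cs).ties) :
      f (F x) = D.coeffHom (MonoidAlgebra.of R _ x) := by
    obtain ⟨x, hx⟩ := x
    induction hx using Submonoid.closure_induction with
    | mem x hx =>
      obtain ⟨w, i, rfl⟩ := hx
      obtain ⟨b, rfl⟩ := artinProj_surjective cs w
      have h1 := congrArg f (hFφ' b ((JuyumayaMap.identity cs).tie' i))
      have h2 := D.braidHom_mul_coeff b ((JuyumayaMap.identity cs).tieElt i)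
      rw [map_mul, map_mul, hFe', hfe,
        show f (φ b : (BTAlgebra R n (q : R))ˣ) = D.braidHom b from hfφ b, h2] at h1
      -- `h1` and `h2` give the claim for `w • e_i` multiplied on the right by the image of a braid
      -- b over w, which is invertible and can be cancelled.
      have h3 : IsUnit (D.braidHom b) := (Group.isUnit b).map D.braidHom
      have h4 := h3.mul_right_cancel h1
      refine h4.trans (congrArg D.coeffHom ?_)
      exact (DFunLike.congr_fun (hρ (artinProj cs b)) _).trans
        (tiesAlgAction_of cs (artinProj cs b) _)
    | one =>
      exact (map_one ((f : _ →* D.MarinRing).comp F)).trans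
        (map_one (
        (D.coeffHom : MonoidAlgebra R (JuyumayaMap.identity cs).ties →* D.MarinRing).comp (MonoidAlgebra.of R _))).symm
    | mul x y hx hy h h' =>
      have h1 := map_mul ((f : _ →* D.MarinRing).comp F) (⟨x, hx⟩ : (JuyumayaMap.identity cs).ties) ⟨y, hy⟩
      have h2 := map_mul (
        (D.coeffHom : MonoidAlgebra R (JuyumayaMap.identity cs).ties →* D.MarinRing).comp (MonoidAlgebra.of R _))
        (⟨x, hx⟩ : (JuyumayaMap.identity cs).ties) ⟨y, hy⟩
      exact h1.trans ((congrArg₂ (· * ·) h h').trans h2.symm)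
  -- The candidate inverse: F extended linearly on coefficients, φ on braids. Equivariance of F is
  -- the commutation rule, and the relation for `g_i²` in 𝓔_n is the Marin relation with `ê_i = 1 +
  -- (q - 1) e_i`.
  obtain ⟨Ψ, hΨc, hΨb⟩ := D.exists_lift (MonoidAlgebra.lift R _ _ F)
    ((Units.coeHom _).comp φ : ArtinGroup (CoxeterMatrix.A (n - 1)) →* _)
    (fun b c => by
      induction c using MonoidAlgebra.induction_linear with
      | zero => simp
      | add x y hx hy => simp only [map_add, add_mul, mul_add, hx, hy]
      | single x r =>
        have h : MonoidAlgebra.single x r = r • MonoidAlgebra.of R _ x := by simp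
        rw [h, map_smul, map_smul, map_smul, smul_mul_assoc, mul_smul_comm, MonoidAlgebra.lift_of]
        have h2 : D.ρ (D.proj b) (MonoidAlgebra.of R _ x) = MonoidAlgebra.of R _
          ((JuyumayaMap.identity cs).tiesAction (artinProj cs b) x) :=
          (DFunLike.congr_fun (hρ _) _).trans (tiesAlgAction_of cs _ _)
        rw [h2, MonoidAlgebra.lift_of]
        exact congrArg (r • ·) (hFφ' b x))
    (fun i => by
      have h : ((Units.coeHom _).comp φ : ArtinGroup (CoxeterMatrix.A (n - 1)) →* _)
          (artinGen _ i) = g (q : R) i := by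
        change (φ _ : BTAlgebra R n (q : R)) = _
        rw [hφ]; rfl
      have h' : MonoidAlgebra.lift R _ _ F ((JuyumayaMap.identity cs).tieElt i) =
          e (q : R) i := by rw [JuyumayaMap.tieElt, MonoidAlgebra.lift_of, hFe']
      change ((Units.coeHom _).comp φ : ArtinGroup (CoxeterMatrix.A (n - 1)) →* _)
          (artinGen _ i) ^ 2 = _ + _ * ((Units.coeHom _).comp φ :
            ArtinGroup (CoxeterMatrix.A (n - 1)) →* _) (artinGen _ i)
      rw [h, ha, map_sub, map_add, map_one, map_smul, h', g_sq, sub_mul,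
        one_mul, add_mul, smul_mul_assoc, mul_sub, mul_one, smul_sub, one_mul]
      abel)
  have h1 : f.comp Ψ = AlgHom.id R _ := by
    refine AlgHom.ext_of_adjoin_eq_top D.adjoin_eq_top ?_
    rintro _ (⟨c, rfl⟩ | ⟨b, rfl⟩)
    · have : (f.comp Ψ).comp D.coeffHom = D.coeffHom := by
        refine MonoidAlgebra.algHom_ext' (MonoidHom.ext fun x => ?_)
          (Subsingleton.elim _ _)
        change f (Ψ (D.coeffHom (MonoidAlgebra.of R _ x))) = D.coeffHom (MonoidAlgebra.of R _ x)
        rw [hΨc, MonoidAlgebra.lift_of, hfF]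
      exact DFunLike.congr_fun this c
    · exact (congrArg f (hΨb b)).trans (hfφ b)
  have h2 : Ψ.comp f = AlgHom.id R _ := by
    refine BTAlgebra.algHom_ext (fun i => ?_) fun i => ?_
    · rw [AlgHom.comp_apply, hfg, ← D.braidHom_gen, hΨb]
      exact congrArg Units.val (hφ i)
    · rw [AlgHom.comp_apply, hfe, hΨc, JuyumayaMap.tieElt, MonoidAlgebra.lift_of, hFe']
      rfl
  exact ⟨AlgEquiv.ofAlgHom f Ψ h1 h2, hfg, hfe⟩

end MainTheorem

end BraidsTies

end

open BraidsTies in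
theorem mainTheorem4 {R : Type*} [CommRing R] (n : ℕ) {W : Type*} [Group W]
    (cs : CoxeterSystem (CoxeterMatrix.A (n - 1)) W)
    (u : Fin (n - 1) → Rˣ) (hu : ConjInvariant cs u) :
    (∃ q : Rˣ, ∀ i, u i = q) ∧
    ∀ q : Rˣ, (∀ i, u i = q) →
      ∃ f : BTAlgebra R n (q : R) ≃ₐ[R]
          ((JuyumayaMap.identity cs).marinDatum u hu).MarinRing,
        (∀ i, f (BTAlgebra.g (q : R) i) =
          ((JuyumayaMap.identity cs).marinDatum u hu).gen i) ∧
        (∀ i, f (BTAlgebra.e (q : R) i) =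
          ((JuyumayaMap.identity cs).marinDatum u hu).coeff
            ((JuyumayaMap.identity cs).tieElt i)) := by
  exact ⟨hu.exists_eq, fun _ hq => exists_marinRing_equiv cs u hu hq⟩
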